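/- **Setting.** Let $G=(V,E)$ be a finite simple graph with edge weights $w:E\to[0,\infty)$, and let $p\in(0,1]$. Each edge is *realized* independently with probability $p$; $E_p\subseteq E$ denotes the random set of realized edges. Fix any deterministic rule $M$ that assigns to every $A\subseteq E$ a maximum weight matching $M(A)\subseteq A$ of $A$, and write $w(F)=\sum_{e\in F}w_e$. For $F\subseteq E$ put $\mathcal M(F)=\mathbb E[\,w(M(F\cap E_p))\,]$, and let $\mathrm{OPT}=\mathcal M(E)$. **Algorithm (parameter $\varepsilon\in(0,1)$).** Let $$R=R(\varepsilon,p)=\left\lceil \frac{2000\,\log(1/\varepsilon)\,\log\!\big(1/(\varepsilon p)\big)}{\varepsilon^4\,p}\right\rceil .$$ Draw $R$ independent realizations $\mathcal E_1,\dots,\mathcal E_R$ of $E$ (each with the law of $E_p$, and all independent of $E_p$), and let $S=M(\mathcal E_1)\cup\dots\cup M(\mathcal E_R)$. Query the edges of $S$ and report the maximum weight matching $M(S\cap E_p)$ of the realized ones. **Theorem.** There is an absolute constant $\varepsilon_0\in(0,1)$ such that for every $\varepsilon\in(0,\varepsilon_0]$ the following hold. 1. For every $p\in(0,1]$, every finite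 simple graph $G$ with nonnegative edge weights $w$, and every rule $M$ as above, the expected weight of the matching reported by the algorithm (over $S$ and $E_p$) satisfies $$\mathbb E\big[w(M(S\cap E_p))\big]=\mathbb E_S[\mathcal M(S)]\ \ge\ 0.501\cdot \mathrm{OPT}.$$ 2. In every outcome of the algorithm, $S\subseteq E$ and every vertex is incident to at most $R(\varepsilon,p)$ edges of $S$. Moreover $R(\varepsilon,p)=O(\log(1/p)/p)$ for fixed $\varepsilon$: for every $p_0<1$ there is a constant $K$, depending only on $\varepsilon$ and $p_0$, such that $R(\varepsilon,p)\le K\,\log(1/p)/p$ for all $0<p\le p_0$. -/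

import Mathlib

/-- A set of edges no two distinct members of which share an endpoint. -/
def IsEdgeMatching {V : Type*} (F : Finset (Sym2 V)) : Prop :=
  ∀ e ∈ F, ∀ e' ∈ F, ∀ v : V, v ∈ e → v ∈ e' → e = e'

/-- `F` is a maximum weight matching contained in the edge set `A`. -/
def IsMaxWeightMatching {V : Type*} (w : Sym2 V → ℝ) (A F : Finset (Sym2 V)) : Prop :=
  (F ⊆ A ∧ IsEdgeMatching F) ∧
    ∀ F' : Finset (Sym2 V), F' ⊆ A → IsEdgeMatching F' → ∑ e ∈ F', w e ≤ ∑ e ∈ F, w e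

/-- The probability that exactly the edges in `A ⊆ E` are realized, when every edge of `E` is
realized independently with probability `p`. -/
def realizationProb {V : Type*} [DecidableEq V] (p : ℝ) (E A : Finset (Sym2 V)) : ℝ :=
  p ^ A.card * (1 - p) ^ (E \ A).card

/-- The expected weight of the maximum matching in the realized part of `F`, where `M` is the
rule that selects a maximum weight matching of an edge set. -/
def expMatching {V : Type*} [DecidableEq V] (w : Sym2 V → ℝ)
    (M : Finset (Sym2 V) → Finset (Sym2 V)) (p : ℝ) (E F : Finset (Sym2 V)) : ℝ :=
  ∑ A ∈ E.powerset, realizationProb p E A * ∑ e ∈ M (F ∩ A), w e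

/-- The number of rounds of the algorithm (rounded up to an integer). -/
noncomputable def numRounds (ε p : ℝ) : ℕ :=
  ⌈2000 * Real.log (1 / ε) * Real.log (1 / (ε * p)) / (ε ^ 4 * p)⌉₊

/-- The edge set queried by the algorithm, when `ω r` is the realization drawn in round `r`. -/
def queriedEdges {V : Type*} [DecidableEq V] (M : Finset (Sym2 V) → Finset (Sym2 V)) {R : ℕ}
    (ω : Fin R → Finset (Sym2 V)) : Finset (Sym2 V) :=
  Finset.univ.biUnion fun r => M (ω r)

/-- The possible outcomes of the `R` draws: a realization of `E` for every round. -/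
def drawOutcomes {V : Type*} [DecidableEq V] (R : ℕ) (E : Finset (Sym2 V)) :
    Finset (Fin R → Finset (Sym2 V)) :=
  Fintype.piFinset fun _ => E.powerset

/-- The expected weight of the matching that the algorithm with `R` rounds reports: the rounds draw
independent realizations of `E`, and the true realization is independent of them. -/
def algExpWeight {V : Type*} [DecidableEq V] (w : Sym2 V → ℝ)
    (M : Finset (Sym2 V) → Finset (Sym2 V)) (p : ℝ) (E : Finset (Sym2 V)) (R : ℕ) : ℝ :=
  ∑ ω ∈ drawOutcomes R E,
    (∏ r, realizationProb p E (ω r)) * expMatching w M p E (queriedEdges M ω)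

/-!
Write `q e` for the probability that the rule `M` uses the edge `e` in a random realization, so that
the optimum is the sum of `q e * w e`. An edge is heavy if `q e` is at least `p / 10 ^ 8`, and light
otherwise. The number of rounds is a large multiple of `1 / p`, so a heavy edge is almost certainly
queried (`le_queried_mean`). A light edge gets the value that is the fraction of rounds using it,
divided by `p` if it is realized; the mean of this value is `q e`, it is small, and by Chebyshev's
inequality the total value of the light edges at a vertex `v` hardly ever exceeds its mean `n v`
noticeably, even on the event that a particular light edge at `v` is used and realized
(`overload_mean_le`, `le_tamePart_mean`).

The two kinds of edges are combined into one fractional matching. Let `A` be the true realization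
and `B` an independent one. The heavy edges of the matching that `M` selects in the realization that
agrees with `A` on heavy edges and with `B` on light ones have marginals `q e` and are independent of
the values of the light edges (`finMean_mixRealization`). Each of these heavy edges, if queried, gets
the value `16 / 25`, and the light edges at a vertex `v` that they cover are damped by a factor of
about `9 / 25 / n v` (if that is less than `1`), so that the degree constraints hold. As `M` covers
`v` by a heavy edge with probability at most `1 - n v`, the damping at `v` costs a light edge at most the maximum of
`(1 - n) * (1 - 9 / 25 / n)`, which is `4 / 25`, whatever the correlation between the two endpoints
of the edge is (`le_dampFactor_mean`). Hence every edge keeps at least `0.6263 * q e` on average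
(`le_combined_mean`).

A matching of at least `4 / 5` of its weight exists by Edmonds' description of the matching polytope
(`sum_mul_le_maxWeight`). After scaling by `4 / 5`, the constraints of odd sets with at least five
vertices follow from the degree constraints, and those of triangles hold because light edges have
small values. As `4 / 5 * 0.6263` exceeds `0.501`, this is enough.

The inequality of Edmonds is proved by taking a minimal weight function `w` that violates it by a
fixed amount. By an exchange argument in the manner of Gallai, all maximum weight matchings for `w`
satisfy some degree constraint or odd set constraint with equality (`exists_tight_constraint`), and
lowering `w` on the edges of that constraint keeps the violation.
-/

/-! ### Matchings and edge counts -/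

theorem IsEdgeMatching.subset {V : Type*} {F F' : Finset (Sym2 V)} (hF : IsEdgeMatching F)
    (h : F' ⊆ F) : IsEdgeMatching F' :=
  fun e he e' he' v hv hv' => hF e (h he) e' (h he') v hv hv'

theorem IsEdgeMatching.card_filter_mem_le_one {V : Type*} [DecidableEq V] {F : Finset (Sym2 V)}
    (hF : IsEdgeMatching F) (v : V) : (F.filter fun e => v ∈ e).card ≤ 1 := by
  rw [Finset.card_le_one]
  intro e he e' he'
  rw [Finset.mem_filter] at he he'
  exact hF e he.1 e' he'.1 v he.2 he'.2

theorem card_filter_mem_eq_two {V : Type*} [DecidableEq V] {e : Sym2 V} (he : ¬ e.IsDiag)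
    {U : Finset V} (hU : ∀ v ∈ e, v ∈ U) : (U.filter fun v => v ∈ e).card = 2 := by
  induction e using Sym2.ind with
  | _ a b =>
    have hab : a ≠ b := by simpa using he
    have : (U.filter fun v => v ∈ s(a, b)) = {a, b} := by
      ext v
      simp only [Finset.mem_filter, Sym2.mem_iff, Finset.mem_insert, Finset.mem_singleton]
      refine ⟨fun h => h.2, fun h => ⟨hU v (by simpa using h), h⟩⟩
    rw [this, Finset.card_pair hab]

theorem sum_sum_filter_mem {V : Type*} [DecidableEq V] (B : Finset (Sym2 V))
    (f : Sym2 V → ℝ) (U : Finset V) :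
    ∑ v ∈ U, ∑ e ∈ B with v ∈ e, f e = ∑ e ∈ B, ((U.filter fun v => v ∈ e).card : ℝ) * f e := by
  simp_rw [Finset.sum_filter]
  rw [Finset.sum_comm]
  refine Finset.sum_congr rfl fun e _ => ?_
  rw [← Finset.sum_filter, Finset.sum_const, nsmul_eq_mul]

/-- Handshake inequality: an edge inside `U` is counted at both of its endpoints. -/
theorem two_mul_sum_inside_le {V : Type*} [Fintype V] [DecidableEq V] {B : Finset (Sym2 V)}
    (hloop : ∀ e ∈ B, ¬ e.IsDiag) {f : Sym2 V → ℝ} (hf : ∀ e ∈ B, 0 ≤ f e) (U : Finset V) :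
    2 * ∑ e ∈ B with ∀ v ∈ e, v ∈ U, f e ≤ ∑ v ∈ U, ∑ e ∈ B with v ∈ e, f e := by
  rw [sum_sum_filter_mem, Finset.mul_sum, Finset.sum_filter]
  refine Finset.sum_le_sum fun e he => ?_
  split_ifs with h
  · rw [card_filter_mem_eq_two (hloop e he) h]; norm_num
  · exact mul_nonneg (by positivity) (hf e he)

theorem IsMaxWeightMatching.of_sum_eq {V : Type*} {w : Sym2 V → ℝ} {A F F' : Finset (Sym2 V)}
    (hF : IsMaxWeightMatching w A F) (hs : F' ⊆ A) (hm : IsEdgeMatching F')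
    (h : ∑ e ∈ F, w e ≤ ∑ e ∈ F', w e) : IsMaxWeightMatching w A F' :=
  ⟨⟨hs, hm⟩, fun F'' h1 h2 => (hF.2 F'' h1 h2).trans h⟩

theorem exists_isMaxWeightMatching {V : Type*} [DecidableEq V] (w : Sym2 V → ℝ)
    (A : Finset (Sym2 V)) : ∃ F, IsMaxWeightMatching w A F := by
  classical
  obtain ⟨F, hF, hmax⟩ := Finset.exists_max_image
    (A.powerset.filter fun F => IsEdgeMatching F) (fun F => ∑ e ∈ F, w e)
    ⟨∅, Finset.mem_filter.2 ⟨Finset.empty_mem_powerset _, fun e he => by simp at he⟩⟩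
  simp only [Finset.mem_filter, Finset.mem_powerset] at hF hmax
  exact ⟨F, hF, fun F' h1 h2 => hmax F' ⟨h1, h2⟩⟩

/-! ### Exchanging two matchings along a component of their symmetric difference -/

/-- A connected graph of maximum degree two has at most two vertices of degree at most one. -/
theorem SimpleGraph.Connected.not_three_leaves {W : Type*} [Fintype W] [DecidableEq W]
    {K : SimpleGraph W} [DecidableRel K.Adj] (hK : K.Connected) (hdeg : ∀ x, K.degree x ≤ 2)
    {a b c : W} (hab : a ≠ b) (hac : a ≠ c) (hbc : b ≠ c)
    (ha : K.degree a ≤ 1) (hb : K.degree b ≤ 1) (hc : K.degree c ≤ 1) : False := by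
  have h1 := hK.card_vert_le_card_edgeSet_add_one
  rw [Nat.card_eq_fintype_card, Nat.card_eq_fintype_card, ← SimpleGraph.edgeFinset_card] at h1
  have h2 := K.sum_degrees_eq_twice_card_edges
  have h3 : ∑ x, (K.degree x + if x ∈ ({a, b, c} : Finset W) then 1 else 0) ≤ ∑ _x : W, 2 := by
    refine Finset.sum_le_sum fun x _ => ?_
    split_ifs with hx
    · simp only [Finset.mem_insert, Finset.mem_singleton] at hx
      rcases hx with rfl | rfl | rfl <;> omega
    · exact hdeg x
  rw [Finset.sum_add_distrib, Finset.sum_ite_mem, Finset.univ_inter, Finset.sum_const,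
    Finset.card_eq_three.2 ⟨a, b, c, hab, hac, hbc, rfl⟩, h2, Finset.sum_const,
    Finset.card_univ] at h3
  simp only [smul_eq_mul, mul_one] at h3
  omega

/-- The same for a graph that need not be connected: three leaves do not share a component. -/
theorem SimpleGraph.not_reachable_three_leaves {V : Type*} [Fintype V] [DecidableEq V]
    {H : SimpleGraph V} [DecidableRel H.Adj] (hdeg : ∀ x, H.degree x ≤ 2)
    {a b c : V} (hab : a ≠ b) (hac : a ≠ c) (hbc : b ≠ c)
    (ha : H.degree a ≤ 1) (hb : H.degree b ≤ 1) (hc : H.degree c ≤ 1) :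
    ¬ (H.Reachable a b ∧ H.Reachable a c) := by
  classical
  rintro ⟨h1, h2⟩
  let C := H.connectedComponentMk a
  have hle : ∀ x : C, C.toSimpleGraph.degree x ≤ H.degree x := by
    intro x
    rw [← SimpleGraph.card_neighborFinset_eq_degree, ← SimpleGraph.card_neighborFinset_eq_degree]
    refine Finset.card_le_card_of_injOn (fun y => (y : V)) ?_ (Subtype.val_injective.injOn)
    intro y hy
    have hxy : C.toSimpleGraph.Adj x y := by simpa using hy
    exact Finset.mem_coe.2 ((SimpleGraph.mem_neighborFinset _ _ _).2 (C.toSimpleGraph_hom.map_adj hxy))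
  have hmem : ∀ {x}, H.Reachable a x → x ∈ C := fun h => SimpleGraph.ConnectedComponent.sound h.symm
  exact C.connected_toSimpleGraph.not_three_leaves (fun x => (hle x).trans (hdeg x))
    (a := ⟨a, hmem (SimpleGraph.Reachable.refl a)⟩) (b := ⟨b, hmem h1⟩) (c := ⟨c, hmem h2⟩)
    (by simpa using hab) (by simpa using hac) (by simpa using hbc)
    ((hle _).trans ha) ((hle _).trans hb) ((hle _).trans hc)

theorem degree_fromEdgeSet_symmDiff_le {V : Type*} [Fintype V] [DecidableEq V]
    (M N : Finset (Sym2 V))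
    [DecidableRel (SimpleGraph.fromEdgeSet (↑(symmDiff M N) : Set (Sym2 V))).Adj] (x : V) :
    (SimpleGraph.fromEdgeSet (↑(symmDiff M N) : Set (Sym2 V))).degree x ≤
      (M.filter fun e => x ∈ e).card + (N.filter fun e => x ∈ e).card := by
  rw [← SimpleGraph.card_neighborFinset_eq_degree]
  refine le_trans ?_ (Finset.card_union_le _ _)
  refine Finset.card_le_card_of_injOn (fun y => s(x, y)) ?_ ?_
  · intro y hy
    have hy' : s(x, y) ∈ symmDiff M N := by
      have := (SimpleGraph.mem_neighborFinset _ _ _).1 hy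
      rw [SimpleGraph.fromEdgeSet_adj] at this
      exact_mod_cast this.1
    rw [Finset.mem_symmDiff] at hy'
    simp only [Finset.coe_union, Finset.coe_filter, Set.mem_union, Set.mem_ofPred_eq,
      Sym2.mem_iff, true_or, and_true]
    tauto
  · intro y _ z _ h
    exact Sym2.congr_right.1 h

/-- If one maximum weight matching misses both `u` and `v` and another one misses `t`, then
exchanging the two along the component of `t` in their symmetric difference, a path that ends in
at most one of `u` and `v`, gives a maximum weight matching that misses `t` and one of `u`, `v`. -/
theorem IsMaxWeightMatching.exists_exchange {V : Type*} [Fintype V] [DecidableEq V]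
    {w : Sym2 V → ℝ} {D M N : Finset (Sym2 V)}
    (hM : IsMaxWeightMatching w D M) (hN : IsMaxWeightMatching w D N)
    {t u v : V} (htu : t ≠ u) (htv : t ≠ v) (huv : u ≠ v)
    (hu : ∀ e ∈ M, u ∉ e) (hv : ∀ e ∈ M, v ∉ e) (ht : ∀ e ∈ N, t ∉ e) :
    ∃ M', IsMaxWeightMatching w D M' ∧ (∀ e ∈ M', t ∉ e) ∧
      ((∀ e ∈ M', u ∉ e) ∨ (∀ e ∈ M', v ∉ e)) := by
  classical
  let H := SimpleGraph.fromEdgeSet (↑(symmDiff M N) : Set (Sym2 V))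
  have hdeg : ∀ x, H.degree x ≤ _ := degree_fromEdgeSet_symmDiff_le M N
  have hM1 := hM.1.2.card_filter_mem_le_one
  have hN1 := hN.1.2.card_filter_mem_le_one
  have miss : ∀ {F : Finset (Sym2 V)} {x : V}, (∀ e ∈ F, x ∉ e) →
      (F.filter fun e => x ∈ e).card = 0 := by
    intro F x h
    rw [Finset.card_eq_zero, Finset.filter_eq_empty_iff]
    exact fun e he => h e he
  have hnot : ¬ (H.Reachable t u ∧ H.Reachable t v) := by
    refine SimpleGraph.not_reachable_three_leaves ?_ htu htv huv ?_ ?_ ?_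
    · intro x; have := hdeg x; have := hM1 x; have := hN1 x; omega
    · have := hdeg t; have := hM1 t; have := miss ht; omega
    · have := hdeg u; have := hN1 u; have := miss hu; omega
    · have := hdeg v; have := hN1 v; have := miss hv; omega
  -- An edge of the symmetric difference that meets the component lies inside it.
  have hadj : ∀ e : Sym2 V, e ∈ symmDiff M N → ∀ x ∈ e, ∀ y ∈ e, H.Reachable t x →
      H.Reachable t y := by
    intro e he x hx y hy hr
    by_cases hxy : x = y
    · exact hxy ▸ hr
    · have : e = s(x, y) := (Sym2.mem_and_mem_iff hxy).1 ⟨hx, hy⟩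
      refine hr.trans (SimpleGraph.Adj.reachable ?_)
      rw [SimpleGraph.fromEdgeSet_adj]
      exact ⟨by rw [← this]; exact_mod_cast he, hxy⟩
  obtain ⟨P, hP⟩ : ∃ P : Sym2 V → Prop, ∀ e, P e ↔ ∃ x ∈ e, H.Reachable t x :=
    ⟨_, fun _ => Iff.rfl⟩
  have key : ∀ e ∈ M, ∀ e' ∈ N, ¬ (P e' ↔ P e) → ∀ x, x ∈ e → x ∈ e' → e = e' := by
    intro e he e' he' hne x hx hx'
    by_cases h' : e' ∈ M
    · exact hM.1.2 e he e' h' x hx hx'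
    by_cases h : e ∈ N
    · exact hN.1.2 e h e' he' x hx hx'
    refine absurd ⟨?_, ?_⟩ hne
    · rw [hP, hP]; rintro ⟨z, hz, hr⟩
      exact ⟨x, hx, hadj e' (Finset.mem_symmDiff.2 (Or.inr ⟨he', h'⟩)) z hz x hx' hr⟩
    · rw [hP, hP]; rintro ⟨z, hz, hr⟩
      exact ⟨x, hx', hadj e (Finset.mem_symmDiff.2 (Or.inl ⟨he, h⟩)) z hz x hx hr⟩
  have hmatch : ∀ Q : Sym2 V → Prop, (∀ e e', Q e → ¬ Q e' → ¬ (P e' ↔ P e)) →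
      IsEdgeMatching (M.filter Q ∪ N.filter fun e => ¬ Q e) := by
    intro Q hQ e he e' he' x hx hx'
    rw [Finset.mem_union, Finset.mem_filter, Finset.mem_filter] at he he'
    rcases he with he | he <;> rcases he' with he' | he'
    · exact hM.1.2 e he.1 e' he'.1 x hx hx'
    · exact key e he.1 e' he'.1 (hQ e e' he.2 he'.2) x hx hx'
    · exact (key e' he'.1 e he.1 (hQ e' e he'.2 he.2) x hx' hx).symm
    · exact hN.1.2 e he.1 e' he'.1 x hx hx'
  have hsub : ∀ Q : Sym2 V → Prop, (M.filter Q ∪ N.filter fun e => ¬ Q e) ⊆ D := fun Q =>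
    Finset.union_subset ((Finset.filter_subset _ _).trans hM.1.1)
      ((Finset.filter_subset _ _).trans hN.1.1)
  have hsum : ∀ Q : Sym2 V → Prop, ∑ e ∈ M.filter Q ∪ N.filter fun e => ¬ Q e, w e =
      ∑ e ∈ M with Q e, w e + ∑ e ∈ N with ¬ Q e, w e := by
    intro Q
    refine Finset.sum_union (Finset.disjoint_left.2 fun e h1 h2 => ?_)
    exact (Finset.mem_filter.1 h2).2 (Finset.mem_filter.1 h1).2
  obtain ⟨Q, hQ⟩ : ∃ Q : Sym2 V → Prop, ∀ e, Q e ↔ ¬ P e := ⟨_, fun _ => Iff.rfl⟩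
  have hmax := hM.2 _ (hsub P) (hmatch P fun e e' h1 h2 h => h2 (h.2 h1))
  have hPQ : ∀ F : Finset (Sym2 V), ∑ e ∈ F with P e, w e = ∑ e ∈ F with ¬ Q e, w e := fun F =>
    Finset.sum_congr (Finset.filter_congr fun e _ => by rw [hQ, not_not]) fun _ _ => rfl
  have hQP : ∀ F : Finset (Sym2 V), ∑ e ∈ F with ¬ P e, w e = ∑ e ∈ F with Q e, w e := fun F =>
    Finset.sum_congr (Finset.filter_congr fun e _ => (hQ e).symm) fun _ _ => rfl
  have hmin : ∑ e ∈ M, w e ≤ ∑ e ∈ M.filter Q ∪ N.filter fun e => ¬ Q e, w e := by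
    have h1 := hN.2 M hM.1.1 hM.1.2
    have h2 := Finset.sum_filter_add_sum_filter_not M Q w
    have h3 := Finset.sum_filter_add_sum_filter_not N Q w
    rw [hsum, hPQ, hQP] at hmax
    rw [hsum]
    linarith
  refine ⟨_, hM.of_sum_eq (hsub Q) (hmatch Q fun e e' h1 h2 h =>
    (hQ e).1 h1 (h.1 (not_not.1 fun h3 => h2 ((hQ e').2 h3)))) hmin, ?_, ?_⟩
  · intro e he hte
    rw [Finset.mem_union, Finset.mem_filter, Finset.mem_filter] at he
    rcases he with he | he
    · exact (hQ e).1 he.2 <| (hP e).2 ⟨t, hte, SimpleGraph.Reachable.refl t⟩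
    · exact ht e he.1 hte
  · have hend : ∀ z, (∀ e ∈ M, z ∉ e) → ¬ H.Reachable t z →
        ∀ e ∈ M.filter Q ∪ N.filter fun e => ¬ Q e, z ∉ e := by
      intro z hz hr e he hze
      rw [Finset.mem_union, Finset.mem_filter, Finset.mem_filter] at he
      rcases he with he | he
      · exact hz e he.1 hze
      · obtain ⟨x, hx, hxr⟩ := (hP e).1 <| not_not.1 fun h => he.2 ((hQ e).2 h)
        exact hr (hadj e (Finset.mem_symmDiff.2 (Or.inr ⟨he.1, fun h => hz e h hze⟩)) x hx z hze hxr)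
    by_cases hr : H.Reachable t u
    · exact Or.inr (hend v hv fun h => hnot ⟨hr, h⟩)
    · exact Or.inl (hend u hu hr)

/-! ### The matching polytope -/

/-- Every weight function is tight on a degree constraint or on an odd set constraint: unless some
vertex is covered by every maximum weight matching, the relation "no maximum weight matching misses
both `x` and `y`" is an equivalence relation, and every maximum weight matching misses at most one
vertex of each of its classes. -/
theorem exists_tight_constraint {V : Type*} [Fintype V] [DecidableEq V] {w : Sym2 V → ℝ}
    {D : Finset (Sym2 V)} (hloop : ∀ e ∈ D, ¬ e.IsDiag) (hw : ∀ e ∈ D, 0 < w e)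
    (hD : D.Nonempty) :
    (∃ u, (D.filter fun e => u ∈ e).Nonempty ∧
      ∀ F, IsMaxWeightMatching w D F → 1 ≤ (F.filter fun e => u ∈ e).card) ∨
    ∃ U : Finset V, Odd U.card ∧ (D.filter fun e => ∀ v ∈ e, v ∈ U).Nonempty ∧
      ∀ F, IsMaxWeightMatching w D F →
        U.card ≤ 2 * (F.filter fun e => ∀ v ∈ e, v ∈ U).card + 1 := by
  classical
  by_cases hcov : ∃ u, ∀ F, IsMaxWeightMatching w D F → ∃ e ∈ F, u ∈ e
  · obtain ⟨u, hu⟩ := hcov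
    refine Or.inl ⟨u, ?_, fun F hF => ?_⟩
    · obtain ⟨F, hF⟩ := exists_isMaxWeightMatching w D
      obtain ⟨e, he, hue⟩ := hu F hF
      exact ⟨e, Finset.mem_filter.2 ⟨hF.1.1 he, hue⟩⟩
    · obtain ⟨e, he, hue⟩ := hu F hF
      exact Finset.card_pos.2 ⟨e, Finset.mem_filter.2 ⟨he, hue⟩⟩
  right
  push Not at hcov
  let rel : V → V → Prop := fun x y =>
    ∀ F, IsMaxWeightMatching w D F → (∀ e ∈ F, x ∉ e) → (∀ e ∈ F, y ∉ e) → x = y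
  have rel_symm : ∀ {x y}, rel x y → rel y x := fun h F hF hy hx => (h F hF hx hy).symm
  have rel_trans : ∀ {x t y}, rel x t → rel t y → rel x y := by
    intro x t y h1 h2 F hF hx hy
    by_contra hxy
    by_cases htx : t = x
    · exact hxy (htx ▸ h2 F hF (htx ▸ hx) hy)
    by_cases hty : t = y
    · exact hxy (hty ▸ h1 F hF hx (hty ▸ hy))
    obtain ⟨N, hN, ht⟩ := hcov t
    obtain ⟨M', hM', ht', h | h⟩ := hF.exists_exchange hN htx hty hxy hx hy ht
    · exact htx (h1 M' hM' h ht').symm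
    · exact hty (h2 M' hM' ht' h)
  -- Otherwise the edge could be added to the matching.
  have rel_edge : ∀ e ∈ D, ∀ x ∈ e, ∀ y ∈ e, rel x y := by
    intro e he x hx y hy F hF hxF hyF
    by_contra hxy
    have hexy : e = s(x, y) := (Sym2.mem_and_mem_iff hxy).1 ⟨hx, hy⟩
    have heF : e ∉ F := fun h => hxF e h hx
    have hno : ∀ e' ∈ F, ∀ z ∈ e, z ∉ e' := by
      intro e' he' z hz hze
      rw [hexy, Sym2.mem_iff] at hz
      rcases hz with rfl | rfl
      exacts [hxF e' he' hze, hyF e' he' hze]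
    have := hF.2 (insert e F) (Finset.insert_subset he hF.1.1) (by
      intro e1 h1 e2 h2 z hz1 hz2
      rw [Finset.mem_insert] at h1 h2
      rcases h1 with rfl | h1 <;> rcases h2 with rfl | h2
      · rfl
      · exact absurd hz2 (hno _ h2 z hz1)
      · exact absurd hz1 (hno _ h1 z hz2)
      · exact hF.1.2 e1 h1 e2 h2 z hz1 hz2)
    rw [Finset.sum_insert heF] at this
    linarith [hw e he]
  obtain ⟨e₀, he₀⟩ := hD
  obtain ⟨a, ha⟩ : ∃ a, a ∈ e₀ := ⟨_, Sym2.out_fst_mem e₀⟩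
  let U : Finset V := Finset.univ.filter fun x => rel a x
  have hU : ∀ {x}, x ∈ U ↔ rel a x := by simp [U]
  have hin : ∀ e ∈ D, ∀ x ∈ e, x ∈ U → ∀ y ∈ e, y ∈ U := fun e he x hx hxU y hy =>
    hU.2 (rel_trans (hU.1 hxU) (rel_edge e he x hx y hy))
  -- The vertices of `U` that a matching covers are twice as many as its edges inside `U`.
  have hcount : ∀ F, IsMaxWeightMatching w D F →
      (U.filter fun x => ∃ e ∈ F, x ∈ e).card = 2 * (F.filter fun e => ∀ v ∈ e, v ∈ U).card := by
    intro F hF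
    have h1 : ∀ x, (if ∃ e ∈ F, x ∈ e then 1 else 0) = ∑ e ∈ F, if x ∈ e then 1 else 0 := by
      intro x
      rw [← Finset.card_filter]
      have := hF.1.2.card_filter_mem_le_one x
      split_ifs with h
      · obtain ⟨e, he, hx⟩ := h
        have : 0 < (F.filter fun e => x ∈ e).card :=
          Finset.card_pos.2 ⟨e, Finset.mem_filter.2 ⟨he, hx⟩⟩
        omega
      · rw [eq_comm, Finset.card_eq_zero, Finset.filter_eq_empty_iff]
        exact fun e he hx => h ⟨e, he, hx⟩
    rw [Finset.card_filter, Finset.sum_congr rfl fun x _ => h1 x, Finset.sum_comm,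
      Finset.card_filter, Finset.mul_sum]
    refine Finset.sum_congr rfl fun e he => ?_
    rw [← Finset.card_filter]
    split_ifs with h
    · rw [card_filter_mem_eq_two (hloop e (hF.1.1 he)) h, mul_one]
    · rw [mul_zero, Finset.card_eq_zero, Finset.filter_eq_empty_iff]
      exact fun x hx hxe => h fun y hy => hin e (hF.1.1 he) x hxe hx y hy
  have hmiss : ∀ F, IsMaxWeightMatching w D F →
      (U.filter fun x => ¬ ∃ e ∈ F, x ∈ e).card ≤ 1 := by
    intro F hF
    rw [Finset.card_le_one]
    intro x hx y hy
    rw [Finset.mem_filter] at hx hy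
    push Not at hx hy
    exact rel_trans (rel_symm (hU.1 hx.1)) (hU.1 hy.1) F hF hx.2 hy.2
  have hsplit : ∀ F : Finset (Sym2 V), (U.filter fun x => ∃ e ∈ F, x ∈ e).card +
      (U.filter fun x => ¬ ∃ e ∈ F, x ∈ e).card = U.card := fun F =>
    Finset.card_filter_add_card_filter_not _
  have haU : a ∈ U := hU.2 fun _ _ _ _ => rfl
  refine ⟨U, ?_, ⟨e₀, Finset.mem_filter.2 ⟨he₀, hin e₀ he₀ a ha haU⟩⟩, fun F hF => ?_⟩
  · obtain ⟨F, hF, haF⟩ := hcov a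
    have h1 : 0 < (U.filter fun x => ¬ ∃ e ∈ F, x ∈ e).card :=
      Finset.card_pos.2 ⟨a, Finset.mem_filter.2 ⟨haU, by push Not; exact haF⟩⟩
    have h2 := hmiss F hF
    have h3 := hcount F hF
    have h4 := hsplit F
    exact ⟨(F.filter fun e => ∀ v ∈ e, v ∈ U).card, by omega⟩
  · have h2 := hmiss F hF
    have h3 := hcount F hF
    have h4 := hsplit F
    omega

/-- Among the weight functions on `B` whose weight at `y` exceeds that of every matching by a fixed
amount, one is minimal. -/
theorem exists_minimal_violation {V : Type*} [Fintype V] [DecidableEq V]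
    {B : Finset (Sym2 V)} {w y : Sym2 V → ℝ} (hw : ∀ e ∈ B, 0 ≤ w e)
    (hviol : ∀ F ⊆ B, IsEdgeMatching F → ∑ e ∈ F, w e < ∑ e ∈ B, y e * w e) :
    ∃ (η : ℝ) (w' : Sym2 V → ℝ), 0 < η ∧ (∀ e ∈ B, 0 ≤ w' e) ∧
      (∀ F ⊆ B, IsEdgeMatching F → η + ∑ e ∈ F, w' e ≤ ∑ e ∈ B, y e * w' e) ∧
      ∀ w'' : Sym2 V → ℝ, (∀ e ∈ B, 0 ≤ w'' e ∧ w'' e ≤ w' e) →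
        (∀ F ⊆ B, IsEdgeMatching F → η + ∑ e ∈ F, w'' e ≤ ∑ e ∈ B, y e * w'' e) →
        ∑ e ∈ B, w' e ≤ ∑ e ∈ B, w'' e := by
  classical
  obtain ⟨F₀, hF₀⟩ := exists_isMaxWeightMatching w B
  let η := ∑ e ∈ B, y e * w e - ∑ e ∈ F₀, w e
  let u : Sym2 V → ℝ := fun e => if e ∈ B then w e else 0
  let K : Set (Sym2 V → ℝ) := Set.Icc 0 u ∩
    {x | ∀ F ⊆ B, IsEdgeMatching F → η + ∑ e ∈ F, x e ≤ ∑ e ∈ B, y e * x e}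
  have hK : IsCompact K := by
    refine isCompact_Icc.inter_right ?_
    simp only [Set.ofPred_forall]
    refine isClosed_iInter fun F => isClosed_iInter fun _ => isClosed_iInter fun _ => ?_
    exact isClosed_le (by fun_prop) (by fun_prop)
  have hu : u ∈ K := by
    refine ⟨⟨fun e => ?_, le_refl _⟩, fun F hF hm => ?_⟩
    · simp only [u, Pi.zero_apply]
      split_ifs with h
      exacts [hw e h, le_refl _]
    · have h1 : ∑ e ∈ F, u e = ∑ e ∈ F, w e :=
        Finset.sum_congr rfl fun e he => if_pos (hF he)
      have h2 : ∑ e ∈ B, y e * u e = ∑ e ∈ B, y e * w e :=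
        Finset.sum_congr rfl fun e he => by rw [show u e = w e from if_pos he]
      rw [h1, h2]
      have := hF₀.2 F hF hm
      simp only [η]
      linarith
  obtain ⟨w', hw', hmin⟩ := hK.exists_isMinOn ⟨u, hu⟩
    (f := fun x : Sym2 V → ℝ => ∑ e ∈ B, x e) (by fun_prop)
  refine ⟨η, w', sub_pos.2 (hviol F₀ hF₀.1.1 hF₀.1.2), fun e _ => hw'.1.1 e, hw'.2, ?_⟩
  intro w'' hb hv
  have hsum : ∀ F ⊆ B, ∑ e ∈ F, (if e ∈ B then w'' e else 0) = ∑ e ∈ F, w'' e := fun F hF =>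
    Finset.sum_congr rfl fun e he => if_pos (hF he)
  have := hmin (a := fun e => if e ∈ B then w'' e else 0) ⟨⟨fun e => ?_, fun e => ?_⟩, fun F hF hm => ?_⟩
  · simpa [hsum B subset_rfl] using this
  · simp only [Pi.zero_apply]
    split_ifs with h
    exacts [(hb e h).1, le_refl _]
  · simp only [u]
    split_ifs with h
    · exact (hb e h).2.trans (by simpa [u, h] using hw'.1.2 e)
    · exact le_refl _
  · rw [hsum F hF]
    refine (hv F hF hm).trans (le_of_eq (Finset.sum_congr rfl fun e he => ?_))
    simp only [if_pos he]

/-- The inequality of Edmonds: a vector that satisfies the degree constraints and the odd set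
constraints weighs at most as much as a maximum weight matching. A minimal violating weight function
could be lowered on the edges of one of its tight constraints. -/
theorem sum_mul_le_maxWeight {V : Type*} [Fintype V] [DecidableEq V]
    {B F : Finset (Sym2 V)} {w y : Sym2 V → ℝ}
    (hloop : ∀ e ∈ B, ¬ e.IsDiag) (hw : ∀ e ∈ B, 0 ≤ w e) (hy : ∀ e ∈ B, 0 ≤ y e)
    (hdeg : ∀ v, ∑ e ∈ B with v ∈ e, y e ≤ 1)
    (hodd : ∀ U : Finset V, Odd U.card →
      2 * ∑ e ∈ B with ∀ v ∈ e, v ∈ U, y e ≤ (U.card : ℝ) - 1)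
    (hF : IsMaxWeightMatching w B F) : ∑ e ∈ B, y e * w e ≤ ∑ e ∈ F, w e := by
  classical
  by_contra hcon
  push Not at hcon
  obtain ⟨η, w', hη, hw', hviol, hmin⟩ :=
    exists_minimal_violation hw fun F' h1 h2 => (hF.2 F' h1 h2).trans_lt hcon
  let D := B.filter fun e => 0 < w' e
  have hDB : D ⊆ B := Finset.filter_subset _ _
  have hpos : ∀ e ∈ D, 0 < w' e := fun e he => (Finset.mem_filter.1 he).2
  have hzero : ∀ e ∈ B, e ∉ D → w' e = 0 := fun e he hD =>
    le_antisymm (not_lt.1 fun h => hD (Finset.mem_filter.2 ⟨he, h⟩)) (hw' e he)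
  have hDne : D.Nonempty := by
    by_contra hne
    rw [Finset.not_nonempty_iff_eq_empty] at hne
    have := hviol ∅ (Finset.empty_subset _) fun e he => absurd he (Finset.notMem_empty e)
    rw [Finset.sum_empty, Finset.sum_eq_zero fun e he => by
      rw [hzero e he (hne ▸ Finset.notMem_empty e), mul_zero]] at this
    linarith
  -- Lowering the weights on the edges of a tight constraint by a small `t` keeps the violation.
  have main : ∀ (T : Finset (Sym2 V)) (k : ℝ), T ⊆ D → T.Nonempty → ∑ e ∈ T, y e ≤ k →
      (∀ N, IsMaxWeightMatching w' D N → k ≤ (N ∩ T).card) → False := by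
    intro T k hTD hT hyk hk
    have hev1 : ∀ᶠ t : ℝ in nhdsWithin 0 (Set.Ioi 0), ∀ e ∈ T, t ≤ w' e := by
      rw [Filter.eventually_all_finset]
      intro e he
      exact nhdsWithin_le_nhds (Filter.Eventually.mono (gt_mem_nhds (hpos e (hTD he)))
        fun t ht => le_of_lt ht)
    obtain ⟨N₀, hN₀⟩ := exists_isMaxWeightMatching w' D
    have hev2 : ∀ᶠ t : ℝ in nhdsWithin 0 (Set.Ioi 0), ∀ N ∈ D.powerset,
        ∑ e ∈ N, w' e < ∑ e ∈ N₀, w' e → ∑ e ∈ N, w' e + t * k ≤ ∑ e ∈ N₀, w' e := by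
      rw [Filter.eventually_all_finset]
      intro N _
      by_cases hlt : ∑ e ∈ N, w' e < ∑ e ∈ N₀, w' e
      · have hc : Filter.Tendsto (fun t : ℝ => ∑ e ∈ N, w' e + t * k) (nhds 0)
            (nhds (∑ e ∈ N, w' e + 0 * k)) := Continuous.tendsto (by fun_prop) 0
        have := hc.eventually_lt_const (by simpa using hlt : _ < ∑ e ∈ N₀, w' e)
        exact nhdsWithin_le_nhds (this.mono fun t ht _ => ht.le)
      · exact Filter.Eventually.of_forall fun t h => absurd h hlt
    obtain ⟨t, ⟨h1, h2⟩, ht⟩ := ((hev1.and hev2).and self_mem_nhdsWithin).exists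
    replace ht : 0 < t := ht
    let w'' : Sym2 V → ℝ := fun e => w' e - if e ∈ T then t else 0
    have hsum : ∀ (N : Finset (Sym2 V)), ∑ e ∈ N, w'' e = ∑ e ∈ N, w' e - t * (N ∩ T).card := by
      intro N
      rw [Finset.sum_sub_distrib, Finset.sum_ite_mem, Finset.sum_const, nsmul_eq_mul, mul_comm t]
    have hle := hmin w'' (fun e he => ⟨?_, ?_⟩) fun N hN hm => ?_
    · rw [hsum, Finset.inter_eq_right.2 (hTD.trans hDB)] at hle
      have : (0 : ℝ) < T.card := by exact_mod_cast Finset.card_pos.2 hT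
      nlinarith
    · simp only [w'']
      split_ifs with h
      · linarith [h1 e h]
      · linarith [hw' e he]
    · simp only [w'']
      split_ifs <;> linarith
    · have hy'' : ∑ e ∈ B, y e * w'' e = ∑ e ∈ B, y e * w' e - t * ∑ e ∈ T, y e := by
        rw [Finset.mul_sum, ← Finset.inter_eq_right.2 (hTD.trans hDB), ← Finset.sum_ite_mem,
          ← Finset.sum_sub_distrib]
        refine Finset.sum_congr rfl fun e _ => ?_
        simp only [w'']
        split_ifs <;> ring
      -- Edges outside the support of the weight play no role.
      have hND : ∑ e ∈ N ∩ D, w' e = ∑ e ∈ N, w' e := by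
        refine Finset.sum_subset Finset.inter_subset_left fun e he hn => ?_
        exact hzero e (hN he) fun hD => hn (Finset.mem_inter.2 ⟨he, hD⟩)
      have hNT : (N ∩ D) ∩ T = N ∩ T := by
        rw [Finset.inter_assoc, Finset.inter_eq_right.2 hTD]
      have hmD : IsEdgeMatching (N ∩ D) := hm.subset Finset.inter_subset_left
      have hbound : ∑ e ∈ N, w'' e ≤ ∑ e ∈ N₀, w' e - t * k := by
        rw [hsum, ← hND, ← hNT]
        have hle := hN₀.2 _ Finset.inter_subset_right hmD
        rcases hle.lt_or_eq with hlt | heq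
        · have := h2 (N ∩ D) (Finset.mem_powerset.2 Finset.inter_subset_right) hlt
          have : 0 ≤ t * ((N ∩ D ∩ T).card : ℝ) := by positivity
          linarith
        · have := hk _ (hN₀.of_sum_eq Finset.inter_subset_right hmD heq.ge)
          nlinarith
      have := hviol N₀ (hN₀.1.1.trans hDB) hN₀.1.2
      rw [hy'']
      nlinarith
  have hfilt : ∀ (p : Sym2 V → Prop) [DecidablePred p] (N : Finset (Sym2 V)), N ⊆ D →
      N ∩ D.filter p = N.filter p := by
    intro p _ N hN
    rw [Finset.inter_filter, Finset.inter_eq_left.2 hN]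
  have hmono : ∀ (p : Sym2 V → Prop) [DecidablePred p],
      ∑ e ∈ D with p e, y e ≤ ∑ e ∈ B with p e, y e := fun p _ =>
    Finset.sum_le_sum_of_subset_of_nonneg (Finset.filter_subset_filter _ hDB)
      fun e he _ => hy e (Finset.mem_filter.1 he).1
  rcases exists_tight_constraint (fun e he => hloop e (hDB he)) hpos hDne with
    ⟨u, hne, hu⟩ | ⟨U, hU, hne, hcard⟩
  · refine main _ 1 (Finset.filter_subset _ _) hne ((hmono _).trans (hdeg u)) fun N hN => ?_
    rw [hfilt _ N hN.1.1]
    exact_mod_cast hu N hN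
  · refine main _ (((U.card : ℝ) - 1) / 2) (Finset.filter_subset _ _) hne ?_ fun N hN => ?_
    · refine (hmono _).trans ?_
      linarith [hodd U hU]
    · rw [hfilt _ N hN.1.1]
      have : (U.card : ℝ) ≤ 2 * ((N.filter fun e => ∀ v ∈ e, v ∈ U).card : ℝ) + 1 := by
        exact_mod_cast hcard N hN
      linarith

/-- Only the odd set constraints of triangles survive a scaling by `4 / 5`: the constraints of the
larger odd sets then follow from the degree constraints. -/
theorem four_fifths_sum_mul_le_maxWeight {V : Type*} [Fintype V] [DecidableEq V]
    {B F : Finset (Sym2 V)} {w y : Sym2 V → ℝ}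
    (hloop : ∀ e ∈ B, ¬ e.IsDiag) (hw : ∀ e ∈ B, 0 ≤ w e) (hy : ∀ e ∈ B, 0 ≤ y e)
    (hdeg : ∀ v, ∑ e ∈ B with v ∈ e, y e ≤ 1)
    (htri : ∀ U : Finset V, U.card = 3 → ∑ e ∈ B with ∀ v ∈ e, v ∈ U, y e ≤ 5 / 4)
    (hF : IsMaxWeightMatching w B F) : 4 / 5 * ∑ e ∈ B, y e * w e ≤ ∑ e ∈ F, w e := by
  have h := sum_mul_le_maxWeight (y := fun e => 4 / 5 * y e) hloop hw
    (fun e he => by linarith [hy e he]) (fun v => ?_) (fun U hU => ?_) hF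
  · simpa only [Finset.mul_sum, mul_assoc] using h
  · rw [← Finset.mul_sum]
    linarith [hdeg v]
  · rw [← Finset.mul_sum]
    have h1 := two_mul_sum_inside_le hloop hy U
    have h2 : ∑ v ∈ U, ∑ e ∈ B with v ∈ e, y e ≤ U.card := by
      simpa using Finset.sum_le_sum fun v (_ : v ∈ U) => hdeg v
    obtain ⟨m, hm⟩ := hU
    rcases Nat.lt_or_ge m 2 with hm2 | hm2
    · interval_cases m
      · obtain ⟨a, rfl⟩ := Finset.card_eq_one.1 hm
        have : (B.filter fun e => ∀ v ∈ e, v ∈ ({a} : Finset V)) = ∅ := by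
          rw [Finset.filter_eq_empty_iff]
          intro e he hin
          have h2 := card_filter_mem_eq_two (hloop e he) hin
          have h3 := Finset.card_filter_le ({a} : Finset V) fun v => v ∈ e
          rw [h2, Finset.card_singleton] at h3
          omega
        rw [this]
        simp
      · have := htri U hm
        rw [hm]
        push_cast
        linarith
    · have : (5 : ℝ) ≤ U.card := by exact_mod_cast (by omega : 5 ≤ U.card)
      linarith

/-! ### Expectations over finite laws -/

/-- The mean of `f` over the finite set `s` of outcomes, where `P x` is the probability of `x`. -/
def finMean {Ω : Type*} (s : Finset Ω) (P f : Ω → ℝ) : ℝ := ∑ x ∈ s, P x * f x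

/-- `P` is a probability law on the finite set `s`. -/
structure IsFinLaw {Ω : Type*} (s : Finset Ω) (P : Ω → ℝ) : Prop where
  nonneg : ∀ x ∈ s, 0 ≤ P x
  sum_eq_one : ∑ x ∈ s, P x = 1

section FinMean

variable {Ω : Type*} {s : Finset Ω} {P : Ω → ℝ}

theorem finMean_congr {f g : Ω → ℝ} (h : ∀ x ∈ s, f x = g x) : finMean s P f = finMean s P g :=
  Finset.sum_congr rfl fun x hx => by rw [h x hx]

theorem finMean_add (f g : Ω → ℝ) :
    finMean s P (fun x => f x + g x) = finMean s P f + finMean s P g := by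
  simp only [finMean, mul_add, Finset.sum_add_distrib]

theorem finMean_sub (f g : Ω → ℝ) :
    finMean s P (fun x => f x - g x) = finMean s P f - finMean s P g := by
  simp only [finMean, mul_sub, Finset.sum_sub_distrib]

theorem finMean_const_mul (c : ℝ) (f : Ω → ℝ) :
    finMean s P (fun x => c * f x) = c * finMean s P f := by
  simp only [finMean, Finset.mul_sum]
  exact Finset.sum_congr rfl fun x _ => by ring

theorem finMean_mul_const (c : ℝ) (f : Ω → ℝ) :
    finMean s P (fun x => f x * c) = finMean s P f * c := by
  simp only [mul_comm _ c, finMean_const_mul]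

theorem finMean_sum {ι : Type*} (t : Finset ι) (f : ι → Ω → ℝ) :
    finMean s P (fun x => ∑ i ∈ t, f i x) = ∑ i ∈ t, finMean s P (f i) := by
  simp only [finMean, Finset.mul_sum]
  exact Finset.sum_comm

theorem finMean_comm {Ω' : Type*} (s' : Finset Ω') (P' : Ω' → ℝ) (f : Ω → Ω' → ℝ) :
    finMean s P (fun x => finMean s' P' (f x)) =
      finMean s' P' fun y => finMean s P fun x => f x y := by
  simp only [finMean, Finset.mul_sum]
  rw [Finset.sum_comm]
  exact Finset.sum_congr rfl fun y _ => Finset.sum_congr rfl fun x _ => by ring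

namespace IsFinLaw

theorem const (hP : IsFinLaw s P) (c : ℝ) : finMean s P (fun _ => c) = c := by
  simp only [finMean, ← Finset.sum_mul, hP.sum_eq_one, one_mul]

theorem mono (hP : IsFinLaw s P) {f g : Ω → ℝ} (h : ∀ x ∈ s, f x ≤ g x) :
    finMean s P f ≤ finMean s P g :=
  Finset.sum_le_sum fun x hx => mul_le_mul_of_nonneg_left (h x hx) (hP.nonneg x hx)

theorem mean_nonneg (hP : IsFinLaw s P) {f : Ω → ℝ} (h : ∀ x ∈ s, 0 ≤ f x) :
    0 ≤ finMean s P f :=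
  Finset.sum_nonneg fun x hx => mul_nonneg (hP.nonneg x hx) (h x hx)

/-- Chebyshev's inequality, weighted by a nonnegative function. -/
theorem chebyshev (hP : IsFinLaw s P) {φ Z : Ω → ℝ} (hφ : ∀ x ∈ s, 0 ≤ φ x) {t : ℝ} (ht : 0 < t) :
    finMean s P (fun x => φ x * if t < Z x then 1 else 0) ≤
      finMean s P (fun x => φ x * Z x ^ 2) / t ^ 2 := by
  rw [le_div_iff₀ (by positivity), ← finMean_mul_const]
  refine hP.mono fun x hx => ?_
  rw [mul_assoc]
  refine mul_le_mul_of_nonneg_left ?_ (hφ x hx)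
  split_ifs with h
  · rw [one_mul]
    exact pow_le_pow_left₀ ht.le h.le 2
  · rw [zero_mul]
    positivity

/-! ### Independent rounds -/

section Rounds

variable {ι : Type*} [Fintype ι] [DecidableEq ι]

theorem finMean_pi_prod (f : ι → Ω → ℝ) :
    finMean (Fintype.piFinset fun _ : ι => s) (fun ω => ∏ r, P (ω r)) (fun ω => ∏ r, f r (ω r)) =
      ∏ r, finMean s P (f r) := by
  simp only [finMean, ← Finset.prod_mul_distrib]
  exact (Finset.prod_univ_sum (fun _ => s) fun r x => P x * f r x).symm

theorem pi (hP : IsFinLaw s P) :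
    IsFinLaw (Fintype.piFinset fun _ : ι => s) (fun ω => ∏ r, P (ω r)) where
  nonneg ω hω := Finset.prod_nonneg fun r _ => hP.nonneg _ (Fintype.mem_piFinset.1 hω r)
  sum_eq_one := by
    rw [← Finset.prod_univ_sum (fun _ => s) fun _ x => P x]
    simp [hP.sum_eq_one]

theorem finMean_pi_eval (hP : IsFinLaw s P) (r : ι) (f : Ω → ℝ) :
    finMean (Fintype.piFinset fun _ : ι => s) (fun ω => ∏ r, P (ω r)) (fun ω => f (ω r)) =
      finMean s P f := by
  have h := finMean_pi_prod (s := s) (P := P) fun i x => if i = r then f x else 1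
  simp only [Finset.prod_ite_eq', Finset.mem_univ, if_true] at h
  rw [h, Finset.prod_eq_single r (fun i _ hi => by simp only [if_neg hi, hP.const])
    (fun h => absurd (Finset.mem_univ r) h)]
  simp

theorem finMean_pi_eval_mul (hP : IsFinLaw s P) {r r' : ι} (hr : r ≠ r') (f g : Ω → ℝ) :
    finMean (Fintype.piFinset fun _ : ι => s) (fun ω => ∏ r, P (ω r))
      (fun ω => f (ω r) * g (ω r')) = finMean s P f * finMean s P g := by
  have h := finMean_pi_prod (s := s) (P := P)
    fun i x => (if i = r then f x else 1) * if i = r' then g x else 1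
  simp only [Finset.prod_mul_distrib, Finset.prod_ite_eq', Finset.mem_univ, if_true] at h
  rw [h, ← Finset.mul_prod_erase _ _ (Finset.mem_univ r),
    ← Finset.mul_prod_erase _ _ (Finset.mem_erase.2 ⟨hr.symm, Finset.mem_univ r'⟩),
    Finset.prod_eq_one fun i hi => ?_]
  · simp [hr, hr.symm]
  · simp only [Finset.mem_erase] at hi
    simp only [if_neg hi.1, if_neg hi.2.1, mul_one, hP.const]

theorem finMean_pi_cross (r : ι) {i j : ι} (hij : i ≠ j) (φ : Ω → ℝ)
    {h : Ω → ℝ} (hh : finMean s P h = 0) :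
    finMean (Fintype.piFinset fun _ : ι => s) (fun ω => ∏ r, P (ω r))
      (fun ω => φ (ω r) * (h (ω i) * h (ω j))) = 0 := by
  have hprod := finMean_pi_prod (s := s) (P := P) fun k x =>
    (if k = r then φ x else 1) * ((if k = i then h x else 1) * if k = j then h x else 1)
  simp only [Finset.prod_mul_distrib, Finset.prod_ite_eq', Finset.mem_univ, if_true] at hprod
  rw [hprod]
  by_cases hir : i = r
  · have hjr : j ≠ r := fun h => hij (hir.trans h.symm)
    refine Finset.prod_eq_zero (Finset.mem_univ j) ?_
    simpa [hjr, hij.symm] using hh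
  · refine Finset.prod_eq_zero (Finset.mem_univ i) ?_
    simpa [hir, hij] using hh

/-- A second moment bound for the deviation of a sum over the rounds from its mean. The weight `φ`
depends on a single round, so that round alone is biased. -/
theorem finMean_pi_deviation_le (hP : IsFinLaw s P) (r : ι) {φ g : Ω → ℝ}
    (hφ : ∀ x ∈ s, 0 ≤ φ x) (hg : ∀ x ∈ s, 0 ≤ g x ∧ g x ≤ 1) :
    finMean (Fintype.piFinset fun _ : ι => s) (fun ω => ∏ r, P (ω r))
      (fun ω => φ (ω r) * (∑ i, (g (ω i) - finMean s P g)) ^ 2) ≤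
      finMean s P φ * (Fintype.card ι * finMean s P g + 1) := by
  set m := finMean s P g with hm
  have hm0 : 0 ≤ m := hP.mean_nonneg fun x hx => (hg x hx).1
  have hm1 : m ≤ 1 := (hP.mono fun x hx => (hg x hx).2).trans (hP.const 1).le
  have hφ0 := hP.mean_nonneg hφ
  have hcenter : finMean s P (fun x => g x - m) = 0 := by
    rw [finMean_sub, hP.const, ← hm, sub_self]
  have hvar : finMean s P (fun x => (g x - m) ^ 2) ≤ m := by
    have h1 : finMean s P (fun x => (g x - m) ^ 2) ≤
        finMean s P (fun x => g x - (2 * m * (g x - m) + m ^ 2)) :=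
      hP.mono fun x hx => by nlinarith [hg x hx]
    rw [finMean_sub, finMean_add, finMean_const_mul, hcenter, hP.const, ← hm] at h1
    nlinarith
  have hexp : ∀ ω : ι → Ω, φ (ω r) * (∑ i, (g (ω i) - m)) ^ 2 =
      ∑ i, ∑ j, φ (ω r) * ((g (ω i) - m) * (g (ω j) - m)) := by
    intro ω
    rw [sq, Finset.sum_mul_sum, Finset.mul_sum]
    simp only [Finset.mul_sum]
  simp only [hexp, finMean_sum]
  have hdiag : ∀ i, ∑ j, finMean (Fintype.piFinset fun _ : ι => s) (fun ω => ∏ r, P (ω r))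
      (fun ω => φ (ω r) * ((g (ω i) - m) * (g (ω j) - m))) ≤
        finMean s P φ * m + if i = r then finMean s P φ else 0 := by
    intro i
    rw [Finset.sum_eq_single i (fun j _ hj => finMean_pi_cross r hj.symm φ hcenter)
      fun h => absurd (Finset.mem_univ i) h]
    split_ifs with hir
    · subst hir
      rw [hP.finMean_pi_eval i fun x => φ x * ((g x - m) * (g x - m))]
      have h2 : finMean s P (fun x => φ x * ((g x - m) * (g x - m))) ≤ finMean s P φ :=
        hP.mono fun x hx => mul_le_of_le_one_right (hφ x hx) (by nlinarith [hg x hx])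
      nlinarith
    · rw [hP.finMean_pi_eval_mul (Ne.symm hir) φ fun x => (g x - m) * (g x - m), add_zero]
      simp only [← sq]
      exact mul_le_mul_of_nonneg_left hvar hφ0
  refine (Finset.sum_le_sum fun i _ => hdiag i).trans (le_of_eq ?_)
  rw [Finset.sum_add_distrib, Finset.sum_ite_eq' Finset.univ r, if_pos (Finset.mem_univ r),
    Finset.sum_const, Finset.card_univ, nsmul_eq_mul]
  ring

/-- The probability that a sum over the rounds exceeds its mean by `t`, on the event that a given
round has a given property. -/
theorem finMean_pi_exceed_le (hP : IsFinLaw s P) (r : ι) {φ g : Ω → ℝ}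
    (hφ : ∀ x ∈ s, 0 ≤ φ x) (hg : ∀ x ∈ s, 0 ≤ g x ∧ g x ≤ 1) {t : ℝ} (ht : 0 < t) :
    finMean (Fintype.piFinset fun _ : ι => s) (fun ω => ∏ r, P (ω r))
      (fun ω => φ (ω r) * if Fintype.card ι * finMean s P g + t < ∑ i, g (ω i) then 1 else 0) ≤
      finMean s P φ * (Fintype.card ι * finMean s P g + 1) / t ^ 2 := by
  have h1 := (hP.pi (ι := ι)).chebyshev (φ := fun ω => φ (ω r))
    (Z := fun ω => ∑ i, (g (ω i) - finMean s P g))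
    (fun ω hω => hφ _ (Fintype.mem_piFinset.1 hω r)) ht
  refine le_trans (le_of_eq (finMean_congr fun ω _ => ?_))
    (h1.trans (div_le_div_of_nonneg_right (hP.finMean_pi_deviation_le r hφ hg) (by positivity)))
  rw [Finset.sum_sub_distrib, Finset.sum_const, Finset.card_univ, nsmul_eq_mul]
  simp only [lt_sub_iff_add_lt, add_comm]

end Rounds

end IsFinLaw

end FinMean

/-! ### Realizations -/

section Realizations

variable {V : Type*} [DecidableEq V] {p : ℝ} {E : Finset (Sym2 V)}

theorem realizationProb_eq_prod {A : Finset (Sym2 V)} (hA : A ⊆ E) :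
    realizationProb p E A = ∏ e ∈ E, if e ∈ A then p else 1 - p := by
  rw [Finset.prod_ite, Finset.prod_const, Finset.prod_const, realizationProb,
    Finset.filter_mem_eq_inter, Finset.inter_eq_right.2 hA, Finset.filter_notMem_eq_sdiff]

theorem isFinLaw_realizationProb (hp0 : 0 ≤ p) (hp1 : p ≤ 1) (E : Finset (Sym2 V)) :
    IsFinLaw E.powerset (realizationProb p E) where
  nonneg A _ := mul_nonneg (pow_nonneg hp0 _) (pow_nonneg (by linarith) _)
  sum_eq_one := by
    have h := Finset.prod_add (fun _ : Sym2 V => p) (fun _ => 1 - p) E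
    simp only [Finset.prod_const, add_sub_cancel, one_pow] at h
    exact h.symm

/-- The realization of an edge is independent of what does not depend on it. -/
theorem finMean_realization_mul_mem {e : Sym2 V} (he : e ∈ E) {G : Finset (Sym2 V) → ℝ}
    (hG : ∀ A, e ∉ A → G (insert e A) = G A) :
    finMean E.powerset (realizationProb p E) (fun A => G A * if e ∈ A then 1 else 0) =
      finMean E.powerset (realizationProb p E) G * p := by
  obtain ⟨E', he', rfl⟩ : ∃ E', e ∉ E' ∧ E = insert e E' :=
    ⟨E.erase e, Finset.notMem_erase e E, (Finset.insert_erase he).symm⟩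
  have key : ∀ A ∈ E'.powerset, e ∉ A ∧
      realizationProb p (insert e E') (insert e A) = p * realizationProb p E' A ∧
      realizationProb p (insert e E') A = (1 - p) * realizationProb p E' A := by
    intro A hA
    rw [Finset.mem_powerset] at hA
    have heA : e ∉ A := fun h => he' (hA h)
    refine ⟨heA, ?_, ?_⟩
    · rw [realizationProb, realizationProb, Finset.card_insert_of_notMem heA,
        Finset.insert_sdiff_insert, Finset.sdiff_insert_of_notMem he', pow_succ]
      ring
    · rw [realizationProb, realizationProb, Finset.insert_sdiff_of_notMem _ heA,
        Finset.card_insert_of_notMem fun h => he' (Finset.mem_sdiff.1 h).1, pow_succ]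
      ring
  simp only [finMean]
  rw [Finset.sum_powerset_insert he', Finset.sum_powerset_insert he', ← Finset.sum_add_distrib,
    ← Finset.sum_add_distrib, Finset.sum_mul]
  refine Finset.sum_congr rfl fun A hA => ?_
  obtain ⟨h1, h2, h3⟩ := key A hA
  rw [h2, h3, hG A h1, if_neg h1, if_pos (Finset.mem_insert_self e A)]
  ring

theorem finMean_realization_mem (hp0 : 0 ≤ p) (hp1 : p ≤ 1) {e : Sym2 V} (he : e ∈ E) :
    finMean E.powerset (realizationProb p E) (fun A => if e ∈ A then 1 else 0) = p := by
  have h := finMean_realization_mul_mem (p := p) he (G := fun _ => 1) fun _ _ => rfl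
  simpa [(isFinLaw_realizationProb hp0 hp1 E).const] using h

/-- A second moment bound for the deviation of a weighted number of realized edges from its mean,
on the event that the edge `e` is realized: only the term of `e` is biased. -/
theorem finMean_realization_deviation_le (hp0 : 0 ≤ p) (hp1 : p ≤ 1) {e : Sym2 V}
    {T : Finset (Sym2 V)} (hT : T ⊆ E) (he : e ∈ T) (b : Sym2 V → ℝ) :
    finMean E.powerset (realizationProb p E) (fun A => (if e ∈ A then 1 else 0) *
      (∑ i ∈ T, b i * ((if i ∈ A then 1 else 0) - p)) ^ 2) ≤
        p * (p * ∑ i ∈ T, b i ^ 2 + b e ^ 2) := by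
  have hP := isFinLaw_realizationProb hp0 hp1 E
  have hcenter : ∀ i ∈ T, ∀ G : Finset (Sym2 V) → ℝ, (∀ A, i ∉ A → G (insert i A) = G A) →
      finMean E.powerset (realizationProb p E)
        (fun A => G A * ((if i ∈ A then 1 else 0) - p)) = 0 := by
    intro i hi G hG
    simp only [mul_sub]
    rw [finMean_sub, finMean_realization_mul_mem (hT hi) hG, finMean_mul_const, sub_self]
  have hne : ∀ {i j : Sym2 V} (A : Finset (Sym2 V)), j ≠ i → (j ∈ insert i A ↔ j ∈ A) :=
    fun A h => by simp [h]
  have hcross : ∀ i ∈ T, ∀ j ∈ T, i ≠ j → finMean E.powerset (realizationProb p E)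
      (fun A => (if e ∈ A then 1 else 0) * ((b i * ((if i ∈ A then 1 else 0) - p)) *
        (b j * ((if j ∈ A then 1 else 0) - p)))) = 0 := by
    have aux : ∀ i ∈ T, ∀ j ∈ T, i ≠ j → i ≠ e → finMean E.powerset (realizationProb p E)
        (fun A => (if e ∈ A then 1 else 0) * ((b i * ((if i ∈ A then 1 else 0) - p)) *
          (b j * ((if j ∈ A then 1 else 0) - p)))) = 0 := by
      intro i hi j hj hij hie
      refine Eq.trans (finMean_congr fun A _ => ?_) (hcenter i hi (fun A =>
        (if e ∈ A then 1 else 0) * b i * (b j * ((if j ∈ A then 1 else 0) - p))) fun A _ => by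
          simp only [hne A hij.symm, hne A hie.symm])
      ring
    intro i hi j hj hij
    by_cases hie : i = e
    · refine Eq.trans (finMean_congr fun A _ => ?_)
        (aux j hj i hi hij.symm fun h => hij (hie.trans h.symm))
      ring
    · exact aux i hi j hj hij hie
  have hexp : ∀ A : Finset (Sym2 V), (if e ∈ A then 1 else 0) *
      (∑ i ∈ T, b i * ((if i ∈ A then 1 else 0) - p)) ^ 2 =
      ∑ i ∈ T, ∑ j ∈ T, (if e ∈ A then 1 else 0) * ((b i * ((if i ∈ A then 1 else 0) - p)) *
        (b j * ((if j ∈ A then 1 else 0) - p))) := by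
    intro A
    rw [sq, Finset.sum_mul_sum, Finset.mul_sum]
    simp only [Finset.mul_sum]
  simp only [hexp, finMean_sum]
  have hdiag : ∀ i ∈ T, ∑ j ∈ T, finMean E.powerset (realizationProb p E)
      (fun A => (if e ∈ A then 1 else 0) * ((b i * ((if i ∈ A then 1 else 0) - p)) *
        (b j * ((if j ∈ A then 1 else 0) - p)))) ≤
        p * (p * b i ^ 2) + if i = e then p * b e ^ 2 else 0 := by
    intro i hi
    rw [Finset.sum_eq_single i (fun j hj hji => hcross i hi j hj hji.symm) fun h => absurd hi h]
    split_ifs with hie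
    · subst hie
      have h1 : finMean E.powerset (realizationProb p E)
          (fun A => (if i ∈ A then 1 else 0) * ((b i * ((if i ∈ A then 1 else 0) - p)) *
            (b i * ((if i ∈ A then 1 else 0) - p)))) ≤
          finMean E.powerset (realizationProb p E)
            (fun A => b i ^ 2 * if i ∈ A then 1 else 0) :=
        hP.mono fun A _ => by
          split_ifs
          · nlinarith [mul_nonneg (sq_nonneg (b i)) (by nlinarith : 0 ≤ 1 - (1 - p) ^ 2)]
          · simp
      rw [finMean_const_mul, finMean_realization_mem hp0 hp1 (hT he)] at h1
      have : 0 ≤ p * (p * b i ^ 2) := by positivity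
      linarith
    · have h1 : finMean E.powerset (realizationProb p E)
          (fun A => (if e ∈ A then 1 else 0) * ((b i * ((if i ∈ A then 1 else 0) - p)) *
            (b i * ((if i ∈ A then 1 else 0) - p)))) =
          finMean E.powerset (realizationProb p E) (fun A =>
            (b i * ((if i ∈ A then 1 else 0) - p)) * (b i * ((if i ∈ A then 1 else 0) - p)) *
              if e ∈ A then 1 else 0) :=
        finMean_congr fun A _ => by ring
      have h2 : finMean E.powerset (realizationProb p E) (fun A =>
            (b i * ((if i ∈ A then 1 else 0) - p)) * (b i * ((if i ∈ A then 1 else 0) - p))) =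
          finMean E.powerset (realizationProb p E) (fun A =>
            b i ^ 2 * (1 - 2 * p) * (if i ∈ A then 1 else 0) + b i ^ 2 * p ^ 2) :=
        finMean_congr fun A _ => by split_ifs <;> ring
      rw [h1, finMean_realization_mul_mem (hT he) fun A _ => by simp only [hne A hie], h2,
        finMean_add, finMean_const_mul, finMean_realization_mem hp0 hp1 (hT hi), hP.const, add_zero]
      nlinarith [mul_nonneg (mul_nonneg (sq_nonneg (b i)) (sq_nonneg p)) hp0]
  refine (Finset.sum_le_sum hdiag).trans (le_of_eq ?_)
  rw [Finset.sum_add_distrib, Finset.sum_ite_eq' T e, if_pos he, ← Finset.mul_sum,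
    ← Finset.mul_sum]
  ring

/-- The realization that agrees with `A` on the edges of `C` and with `B` elsewhere. -/
def mixRealization (C A B : Finset (Sym2 V)) : Finset (Sym2 V) := A ∩ C ∪ B \ C

theorem mem_mixRealization {C A B : Finset (Sym2 V)} {e : Sym2 V} :
    e ∈ mixRealization C A B ↔ e ∈ A ∧ e ∈ C ∨ e ∈ B ∧ e ∉ C := by
  simp [mixRealization]

/-- Let `A` and `B` be independent realizations. The realization that takes the edges of `C`
from `A` and the others from `B` is again a realization, and it is independent of the part of `A`
outside `C`: exchanging the parts of `A` and `B` outside `C` preserves the law of the pair. -/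
theorem finMean_mixRealization (C : Finset (Sym2 V)) (F G : Finset (Sym2 V) → ℝ)
    (hG : ∀ A, G (A \ C) = G A) :
    finMean E.powerset (realizationProb p E) (fun A => finMean E.powerset (realizationProb p E)
      fun B => F (mixRealization C A B) * G A) =
    finMean E.powerset (realizationProb p E) F * finMean E.powerset (realizationProb p E) G := by
  have hsub : ∀ {A B : Finset (Sym2 V)}, A ⊆ E → B ⊆ E → mixRealization C A B ⊆ E :=
    fun hA hB => Finset.union_subset (Finset.inter_subset_left.trans hA)
      (Finset.sdiff_subset.trans hB)
  have hinv : ∀ A B : Finset (Sym2 V),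
      mixRealization C (mixRealization C A B) (mixRealization C B A) = A := by
    intro A B
    ext e
    simp only [mem_mixRealization]
    tauto
  simp only [finMean]
  rw [Finset.sum_mul_sum]
  simp only [Finset.mul_sum]
  rw [← Finset.sum_product', ← Finset.sum_product']
  refine Finset.sum_nbij' (fun x => (mixRealization C x.1 x.2, mixRealization C x.2 x.1))
    (fun x => (mixRealization C x.1 x.2, mixRealization C x.2 x.1)) ?_ ?_ ?_ ?_ ?_
  · intro x hx
    simp only [Finset.mem_product, Finset.mem_powerset] at hx ⊢
    exact ⟨hsub hx.1 hx.2, hsub hx.2 hx.1⟩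
  · intro x hx
    simp only [Finset.mem_product, Finset.mem_powerset] at hx ⊢
    exact ⟨hsub hx.1 hx.2, hsub hx.2 hx.1⟩
  · intro x _
    simp only [hinv]
  · intro x _
    simp only [hinv]
  · intro x hx
    simp only [Finset.mem_product, Finset.mem_powerset] at hx
    have hG' : G (mixRealization C x.2 x.1) = G x.1 := by
      rw [← hG, ← hG x.1]
      congr 1
      ext e
      simp only [Finset.mem_sdiff, mem_mixRealization]
      tauto
    have hprob : realizationProb p E (mixRealization C x.1 x.2) *
        realizationProb p E (mixRealization C x.2 x.1) =
        realizationProb p E x.1 * realizationProb p E x.2 := by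
      rw [realizationProb_eq_prod (hsub hx.1 hx.2), realizationProb_eq_prod (hsub hx.2 hx.1),
        realizationProb_eq_prod hx.1, realizationProb_eq_prod hx.2, ← Finset.prod_mul_distrib,
        ← Finset.prod_mul_distrib]
      refine Finset.prod_congr rfl fun e _ => ?_
      by_cases hC : e ∈ C <;> simp [mem_mixRealization, hC, mul_comm]
    rw [hG']
    linear_combination -(F (mixRealization C x.1 x.2) * G x.1) * hprob

end Realizations

/-! ### How often the rule uses an edge -/

/-- The mean of a function of one realization of `E`. -/
local notation "𝔼[" p "," E "]" => finMean (Finset.powerset E) (realizationProb p E)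

/-- The mean of a function of `R` independent realizations of `E`. -/
local notation "𝔼^[" R "," p "," E "]" =>
  finMean (Fintype.piFinset fun _ : Fin R => Finset.powerset E)
    (fun ω => ∏ r, realizationProb p E (ω r))

section MatchProb

variable {V : Type*} [DecidableEq V] {M : Finset (Sym2 V) → Finset (Sym2 V)} {p : ℝ}
  {E : Finset (Sym2 V)}

/-- The probability that the rule `M` puts the edge `e` into the matching of a realization. -/
def matchProb (M : Finset (Sym2 V) → Finset (Sym2 V)) (p : ℝ) (E : Finset (Sym2 V))
    (e : Sym2 V) : ℝ :=
  𝔼[p,E] fun A => if e ∈ M A then 1 else 0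

/-- The expected number of edges at `v` that belong to both `N` and the matching of a realization,
which is the probability that this matching covers `v` by an edge of `N`. -/
def coverProb (M : Finset (Sym2 V) → Finset (Sym2 V)) (p : ℝ) (E N : Finset (Sym2 V)) (v : V) : ℝ :=
  ∑ e ∈ N with v ∈ e, matchProb M p E e

theorem matchProb_nonneg (hp0 : 0 ≤ p) (hp1 : p ≤ 1) (e : Sym2 V) : 0 ≤ matchProb M p E e :=
  (isFinLaw_realizationProb hp0 hp1 E).mean_nonneg fun A _ => by split_ifs <;> norm_num

theorem coverProb_nonneg (hp0 : 0 ≤ p) (hp1 : p ≤ 1) (N : Finset (Sym2 V)) (v : V) :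
    0 ≤ coverProb M p E N v :=
  Finset.sum_nonneg fun e _ => matchProb_nonneg hp0 hp1 e

theorem finMean_sum_ite_mem_eq_sum_matchProb (T : Finset (Sym2 V)) :
    𝔼[p,E] (fun A => ∑ e ∈ T, if e ∈ M A then 1 else 0) = ∑ e ∈ T, matchProb M p E e :=
  finMean_sum T fun e A => if e ∈ M A then 1 else 0

theorem expMatching_eq_sum {w : Sym2 V → ℝ} (hM : ∀ A ⊆ E, M A ⊆ A) :
    expMatching w M p E E = ∑ e ∈ E, matchProb M p E e * w e := by
  simp only [matchProb, ← finMean_mul_const]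
  rw [← finMean_sum]
  refine finMean_congr fun A hA => ?_
  rw [Finset.mem_powerset] at hA
  simp only [ite_mul, one_mul, zero_mul]
  rw [Finset.sum_ite_mem, Finset.inter_eq_right.2 hA,
    Finset.inter_eq_right.2 ((hM A hA).trans hA)]

theorem sum_ite_mem_le_one {F : Finset (Sym2 V)} (hF : IsEdgeMatching F) {T : Finset (Sym2 V)}
    {v : V} (hT : ∀ e ∈ T, v ∈ e) : ∑ e ∈ T, (if e ∈ F then (1 : ℝ) else 0) ≤ 1 := by
  rw [Finset.sum_ite_mem, Finset.sum_const, nsmul_one]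
  have h1 : (T ∩ F).card ≤ (F.filter fun e => v ∈ e).card := Finset.card_le_card fun e he => by
    rw [Finset.mem_inter] at he
    exact Finset.mem_filter.2 ⟨he.2, hT e he.1⟩
  exact_mod_cast h1.trans (hF.card_filter_mem_le_one v)

theorem coverProb_add_coverProb_le_one (hp0 : 0 ≤ p) (hp1 : p ≤ 1)
    (hM : ∀ A ⊆ E, IsEdgeMatching (M A)) (C : Finset (Sym2 V)) (hC : C ⊆ E) (v : V) :
    coverProb M p E C v + coverProb M p E (E \ C) v ≤ 1 := by
  have hP := isFinLaw_realizationProb hp0 hp1 E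
  have h : coverProb M p E C v + coverProb M p E (E \ C) v =
      ∑ e ∈ E with v ∈ e, matchProb M p E e := by
    simp only [coverProb, Finset.sum_filter]
    rw [add_comm, Finset.sum_sdiff hC]
  rw [h, ← finMean_sum_ite_mem_eq_sum_matchProb]
  refine (hP.mono fun A hA => ?_).trans (hP.const 1).le
  exact sum_ite_mem_le_one (hM A (Finset.mem_powerset.1 hA)) fun e he => (Finset.mem_filter.1 he).2

end MatchProb

/-! ### The combined fractional matching -/

section Combined

variable {V : Type*} [DecidableEq V]

/-- By how much the light edges at `v` are damped when `F` covers `v`. The value `n v` is their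
expected load at `v`; the damped load leaves room for `16 / 25` units of the edge of `F`. -/
noncomputable def damp (F : Finset (Sym2 V)) (n : V → ℝ) (v : V) : ℝ :=
  if ∃ e ∈ F, v ∈ e then 99 / 100 - min (99 / 100) (9 / 25 / (n v + 1 / 100)) else 0

/-- The light edge `e` has a small value, and neither of its endpoints is overloaded. -/
def IsTame (N : Finset (Sym2 V)) (X : Sym2 V → ℝ) (n : V → ℝ) (e : Sym2 V) : Prop :=
  X e ≤ 3 / 10 ∧ ∀ v ∈ e, ∑ i ∈ N with v ∈ i, X i ≤ n v + 1 / 100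

open Classical in
/-- The part of the light edge `e` that is kept. -/
noncomputable def tamePart (N : Finset (Sym2 V)) (X : Sym2 V → ℝ) (n : V → ℝ) (e : Sym2 V) : ℝ :=
  if IsTame N X n e then X e else 0

variable {S F N E : Finset (Sym2 V)} {X : Sym2 V → ℝ} {n : V → ℝ}

theorem damp_nonneg (v : V) : 0 ≤ damp F n v := by
  unfold damp
  split_ifs
  · linarith [min_le_left (99 / 100 : ℝ) (9 / 25 / (n v + 1 / 100))]
  · exact le_refl _

theorem damp_le (hn : ∀ v, 0 ≤ n v) (v : V) : damp F n v ≤ 99 / 100 := by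
  unfold damp
  split_ifs
  · have : (0 : ℝ) ≤ min (99 / 100) (9 / 25 / (n v + 1 / 100)) :=
      le_min (by norm_num) (div_nonneg (by norm_num) (by linarith [hn v]))
    linarith
  · norm_num

theorem tamePart_nonneg (hX : ∀ e, 0 ≤ X e) (e : Sym2 V) : 0 ≤ tamePart N X n e := by
  unfold tamePart
  split_ifs
  exacts [hX e, le_refl _]

theorem tamePart_le (e : Sym2 V) : tamePart N X n e ≤ 3 / 10 := by
  unfold tamePart
  split_ifs with h
  exacts [h.1, by norm_num]

theorem sum_tamePart_le (hX : ∀ e, 0 ≤ X e) (hn : ∀ v, 0 ≤ n v) (v : V) :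
    ∑ e ∈ N with v ∈ e, tamePart N X n e ≤ n v + 1 / 100 := by
  by_cases h : ∃ e ∈ N, v ∈ e ∧ IsTame N X n e
  · obtain ⟨e, _, hv, ht⟩ := h
    refine le_trans (Finset.sum_le_sum fun i _ => ?_) (ht.2 v hv)
    unfold tamePart
    split_ifs
    exacts [le_refl _, hX i]
  · push Not at h
    rw [Finset.sum_eq_zero fun e he => ?_]
    · linarith [hn v]
    · rw [Finset.mem_filter] at he
      exact if_neg (h e he.1 he.2)

variable [Fintype V]

/-- The factor by which a light edge is damped. -/
noncomputable def dampFactor (F : Finset (Sym2 V)) (n : V → ℝ) (e : Sym2 V) : ℝ :=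
  max 0 (99 / 100 - ∑ v with v ∈ e, damp F n v)

/-- The fractional matching that combines the matching `F`, as far as `S` contains it, with the
values `X` on the set `N` of light edges. -/
noncomputable def combined (S F N : Finset (Sym2 V)) (X : Sym2 V → ℝ) (n : V → ℝ)
    (e : Sym2 V) : ℝ :=
  if e ∈ N then dampFactor F n e * tamePart N X n e else 16 / 25 * if e ∈ F ∧ e ∈ S then 1 else 0

theorem dampFactor_nonneg (e : Sym2 V) : 0 ≤ dampFactor F n e := le_max_left _ _

theorem dampFactor_le (hn : ∀ v, 0 ≤ n v) {e : Sym2 V} {v : V} (hv : v ∈ e) :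
    dampFactor F n e ≤ 99 / 100 - damp F n v := by
  refine max_le (by linarith [damp_le (F := F) hn v]) ?_
  have := Finset.single_le_sum (f := damp F n) (fun u _ => damp_nonneg u)
    (Finset.mem_filter.2 ⟨Finset.mem_univ v, hv⟩ : v ∈ Finset.univ.filter fun v => v ∈ e)
  linarith

theorem dampFactor_le_one (e : Sym2 V) : dampFactor F n e ≤ 1 := by
  refine max_le zero_le_one ?_
  have := Finset.sum_nonneg fun (u : V) (_ : u ∈ Finset.univ.filter fun v => v ∈ e) =>
    damp_nonneg (F := F) (n := n) u
  linarith

theorem combined_nonneg (hX : ∀ e, 0 ≤ X e) (e : Sym2 V) : 0 ≤ combined S F N X n e := by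
  unfold combined
  split_ifs
  · exact mul_nonneg (dampFactor_nonneg e) (tamePart_nonneg hX e)
  all_goals norm_num

/-- The degree constraints. An edge of `F` at `v` takes `16 / 25`, and then the load of the light
edges at `v` is damped to at most `9 / 25`. -/
theorem sum_combined_le_one (hF : IsEdgeMatching F) (hNE : N ⊆ E)
    (hX : ∀ e, 0 ≤ X e) (hn : ∀ v, 0 ≤ n v) (hn1 : ∀ v, n v ≤ 1) (v : V) :
    ∑ e ∈ E with v ∈ e, combined S F N X n e ≤ 1 := by
  have hlight : ∑ e ∈ N with v ∈ e, combined S F N X n e ≤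
      (99 / 100 - damp F n v) * (n v + 1 / 100) := by
    refine le_trans ?_ (mul_le_mul_of_nonneg_left (sum_tamePart_le (N := N) hX hn v)
      (by linarith [damp_le (F := F) hn v]))
    rw [Finset.mul_sum]
    refine Finset.sum_le_sum fun e he => ?_
    rw [Finset.mem_filter] at he
    rw [combined, if_pos he.1]
    exact mul_le_mul_of_nonneg_right (dampFactor_le hn he.2) (tamePart_nonneg hX e)
  have hheavy : ∑ e ∈ E \ N with v ∈ e, combined S F N X n e ≤
      16 / 25 * ∑ e ∈ E \ N with v ∈ e, if e ∈ F then 1 else 0 := by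
    rw [Finset.mul_sum]
    refine Finset.sum_le_sum fun e he => ?_
    rw [Finset.mem_filter, Finset.mem_sdiff] at he
    rw [combined, if_neg he.1.2]
    refine mul_le_mul_of_nonneg_left ?_ (by norm_num)
    split_ifs <;> first | tauto | norm_num
  have hsplit : ∑ e ∈ E with v ∈ e, combined S F N X n e =
      ∑ e ∈ E \ N with v ∈ e, combined S F N X n e +
        ∑ e ∈ N with v ∈ e, combined S F N X n e := by
    simp only [Finset.sum_filter]
    rw [Finset.sum_sdiff hNE]
  have hn0 := hn v
  have hn1' := hn1 v
  rw [hsplit]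
  by_cases hcov : ∃ e ∈ F, v ∈ e
  · have h1 : ∑ e ∈ E \ N with v ∈ e, (if e ∈ F then (1 : ℝ) else 0) ≤ 1 :=
      sum_ite_mem_le_one hF fun e he => (Finset.mem_filter.1 he).2
    have h2 : (99 / 100 - damp F n v) * (n v + 1 / 100) ≤ 9 / 25 := by
      rw [damp, if_pos hcov, sub_sub_cancel, ← le_div_iff₀ (by linarith)]
      exact min_le_right _ _
    linarith
  · have h1 : ∑ e ∈ E \ N with v ∈ e, (if e ∈ F then (1 : ℝ) else 0) = 0 :=
      Finset.sum_eq_zero fun e he => if_neg fun h => hcov ⟨e, h, (Finset.mem_filter.1 he).2⟩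
    rw [damp, if_neg hcov] at hlight
    nlinarith

/-- The constraints of triangles: at most one of the three edges belongs to `F`, and the others are
light, hence have small values. -/
theorem sum_combined_triangle_le (hloop : ∀ e ∈ E, ¬ e.IsDiag) (hF : IsEdgeMatching F)
    (hX : ∀ e, 0 ≤ X e) {U : Finset V} (hU : U.card = 3) :
    ∑ e ∈ E with ∀ v ∈ e, v ∈ U, combined S F N X n e ≤ 5 / 4 := by
  set T := E.filter fun e => ∀ v ∈ e, v ∈ U with hT
  have hTE : ∀ e ∈ T, e ∈ E ∧ ∀ v ∈ e, v ∈ U := fun e he => Finset.mem_filter.1 he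
  have hcard : T.card ≤ 3 := by
    have h1 : T ⊆ U.offDiag.image Sym2.mk.uncurry := by
      intro e he
      obtain ⟨heE, heU⟩ := hTE e he
      have hd := hloop e heE
      induction e using Sym2.ind with
      | _ a b =>
        exact Finset.mem_image.2 ⟨(a, b), Finset.mem_offDiag.2
          ⟨heU a (by simp), heU b (by simp), by simpa using hd⟩, rfl⟩
    refine (Finset.card_le_card h1).trans ?_
    rw [Sym2.card_image_offDiag, hU]
    decide
  have hpoint : ∀ e ∈ T, combined S F N X n e ≤ 3 / 10 + 17 / 50 * if e ∈ F then 1 else 0 := by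
    intro e _
    have h1 := tamePart_le (N := N) (X := X) (n := n) e
    have h2 := tamePart_nonneg (N := N) (n := n) hX e
    have h3 := dampFactor_le_one (F := F) (n := n) e
    have h4 := dampFactor_nonneg (F := F) (n := n) e
    unfold combined
    split_ifs <;> first | nlinarith | tauto
  -- Two edges inside a set of three vertices share a vertex.
  have hone : ∑ e ∈ T, (if e ∈ F then (1 : ℝ) else 0) ≤ 1 := by
    rw [Finset.sum_ite_mem, Finset.sum_const, nsmul_one]
    suffices (T ∩ F).card ≤ 1 by exact_mod_cast this
    rw [Finset.card_le_one]
    intro a ha b hb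
    rw [Finset.mem_inter] at ha hb
    by_contra hab
    have hd : Disjoint (U.filter fun v => v ∈ a) (U.filter fun v => v ∈ b) := by
      rw [Finset.disjoint_left]
      intro v hva hvb
      rw [Finset.mem_filter] at hva hvb
      exact hab (hF a ha.2 b hb.2 v hva.2 hvb.2)
    have h1 := Finset.card_le_card (Finset.union_subset
      (Finset.filter_subset (fun v => v ∈ a) U) (Finset.filter_subset (fun v => v ∈ b) U))
    rw [Finset.card_union_of_disjoint hd,
      card_filter_mem_eq_two (hloop a (hTE a ha.1).1) (hTE a ha.1).2,
      card_filter_mem_eq_two (hloop b (hTE b hb.1).1) (hTE b hb.1).2] at h1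
    omega
  have hcard' : (T.card : ℝ) ≤ 3 := by exact_mod_cast hcard
  have h := Finset.sum_le_sum hpoint
  rw [Finset.sum_add_distrib, ← Finset.mul_sum, Finset.sum_const, nsmul_eq_mul] at h
  linarith

/-- The combined fractional matching is a lower bound for the weight of a maximum weight matching of
every edge set that supports it. -/
theorem four_fifths_sum_combined_le {w : Sym2 V → ℝ} {B F' : Finset (Sym2 V)}
    (hloop : ∀ e ∈ E, ¬ e.IsDiag) (hw : ∀ e ∈ E, 0 ≤ w e) (hF : IsEdgeMatching F) (hNE : N ⊆ E)
    (hX : ∀ e, 0 ≤ X e) (hn : ∀ v, 0 ≤ n v) (hn1 : ∀ v, n v ≤ 1) (hB : B ⊆ E)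
    (hsupp : ∀ e ∈ E, e ∉ B → combined S F N X n e = 0) (hF' : IsMaxWeightMatching w B F') :
    4 / 5 * ∑ e ∈ E, combined S F N X n e * w e ≤ ∑ e ∈ F', w e := by
  have hle : ∀ (P : Sym2 V → Prop) [DecidablePred P],
      ∑ e ∈ B with P e, combined S F N X n e ≤ ∑ e ∈ E with P e, combined S F N X n e :=
    fun P _ => Finset.sum_le_sum_of_subset_of_nonneg (Finset.filter_subset_filter _ hB)
      fun e _ _ => combined_nonneg hX e
  have hsum : ∑ e ∈ B, combined S F N X n e * w e = ∑ e ∈ E, combined S F N X n e * w e :=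
    Finset.sum_subset hB fun e he hn => by rw [hsupp e he hn, zero_mul]
  rw [← hsum]
  exact four_fifths_sum_mul_le_maxWeight (fun e he => hloop e (hB he)) (fun e he => hw e (hB he))
    (fun e _ => combined_nonneg hX e)
    (fun v => (hle _).trans (sum_combined_le_one hF hNE hX hn hn1 v))
    (fun U hU => (hle _).trans (sum_combined_triangle_le hloop hF hX hU)) hF'

end Combined

/-! ### The expected value of the combined fractional matching -/

section Expectation

variable {V : Type*} [DecidableEq V] {M : Finset (Sym2 V) → Finset (Sym2 V)} {p : ℝ}
  {C E : Finset (Sym2 V)} {R : ℕ}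

theorem queriedEdges_subset (hM : ∀ A ⊆ E, M A ⊆ A) {ω : Fin R → Finset (Sym2 V)}
    (hω : ω ∈ drawOutcomes R E) : queriedEdges M ω ⊆ E := by
  refine Finset.biUnion_subset.2 fun r _ => ?_
  have := Finset.mem_powerset.1 (Fintype.mem_piFinset.1 hω r)
  exact (hM _ this).trans this

theorem card_queriedEdges_filter_le (hM : ∀ A ⊆ E, IsEdgeMatching (M A))
    {ω : Fin R → Finset (Sym2 V)} (hω : ω ∈ drawOutcomes R E) (v : V) :
    ((queriedEdges M ω).filter fun e => v ∈ e).card ≤ R := by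
  rw [queriedEdges, Finset.filter_biUnion]
  refine Finset.card_biUnion_le.trans ((Finset.sum_le_sum fun r _ =>
    (hM _ (Finset.mem_powerset.1 (Fintype.mem_piFinset.1 hω r))).card_filter_mem_le_one v).trans ?_)
  simp

/-- The value of the light edge `e`: the fraction of the rounds that use it, divided by `p` if `e` is
realized, and zero otherwise. -/
noncomputable def lightValue (M : Finset (Sym2 V) → Finset (Sym2 V)) (p : ℝ) {R : ℕ}
    (ω : Fin R → Finset (Sym2 V)) (A : Finset (Sym2 V)) (e : Sym2 V) : ℝ :=
  if e ∈ A then (∑ r, if e ∈ M (ω r) then 1 else 0) / (R * p) else 0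

theorem lightValue_nonneg (hp0 : 0 ≤ p) (ω : Fin R → Finset (Sym2 V)) (A : Finset (Sym2 V))
    (e : Sym2 V) : 0 ≤ lightValue M p ω A e := by
  unfold lightValue
  split_ifs
  · exact div_nonneg (Finset.sum_nonneg fun r _ => by split_ifs <;> norm_num)
      (mul_nonneg (Nat.cast_nonneg _) hp0)
  · exact le_refl _

theorem damp_mean_le (hp0 : 0 ≤ p) (hp1 : p ≤ 1) (hM : ∀ A ⊆ E, IsEdgeMatching (M A))
    (hC : C ⊆ E) (v : V) :
    𝔼[p,E] (fun A => damp (M A ∩ C) (coverProb M p E (E \ C)) v) ≤ 4 / 25 := by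
  have hP := isFinLaw_realizationProb hp0 hp1 E
  have hn := coverProb_nonneg (M := M) (E := E) hp0 hp1 (E \ C) v
  have hc := coverProb_nonneg (M := M) (E := E) hp0 hp1 C v
  have hcn := coverProb_add_coverProb_le_one hp0 hp1 hM C hC v
  set n := coverProb M p E (E \ C) with hndef
  set δ : ℝ := 99 / 100 - min (99 / 100) (9 / 25 / (n v + 1 / 100)) with hδ
  have hδ0 : 0 ≤ δ := by linarith [min_le_left (99 / 100 : ℝ) (9 / 25 / (n v + 1 / 100))]
  have h1 : 𝔼[p,E] (fun A => damp (M A ∩ C) n v) ≤ δ * coverProb M p E C v := by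
    rw [coverProb, ← finMean_sum_ite_mem_eq_sum_matchProb, ← finMean_const_mul]
    refine hP.mono fun A _ => ?_
    have hnn : ∀ e ∈ C.filter fun e => v ∈ e, (0 : ℝ) ≤ if e ∈ M A then 1 else 0 :=
      fun e _ => by split_ifs <;> norm_num
    unfold damp
    split_ifs with h
    · obtain ⟨e, he, hv⟩ := h
      rw [Finset.mem_inter] at he
      have := Finset.single_le_sum hnn (Finset.mem_filter.2 ⟨he.2, hv⟩)
      rw [if_pos he.1] at this
      exact le_mul_of_one_le_right hδ0 this
    · exact mul_nonneg hδ0 (Finset.sum_nonneg hnn)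
  refine h1.trans ((mul_le_mul_of_nonneg_left (by linarith : _ ≤ 1 - n v) hδ0).trans ?_)
  rcases min_cases (99 / 100 : ℝ) (9 / 25 / (n v + 1 / 100)) with ⟨hmin, _⟩ | ⟨hmin, _⟩
  · rw [hδ, hmin]
    norm_num
  -- With `m = n v + 1 / 100` this is the positivity of a quadratic polynomial in `m`.
  · have hm : 0 < n v + 1 / 100 := by linarith
    rw [hδ, hmin]
    have h2 : (99 / 100 - 9 / 25 / (n v + 1 / 100)) * (1 - n v) =
        (99 / 100 * (n v + 1 / 100) - 9 / 25) * (1 - n v) / (n v + 1 / 100) := by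
      field_simp
    rw [h2, div_le_iff₀ hm]
    nlinarith [sq_nonneg (n v - 6 / 10)]

variable [Fintype V] in
/-- A light edge is kept to more than one half on average: an endpoint that is covered by heavy
edges with probability `c` has light load at most `1 - c`, so it is damped little unless `c` is
small. -/
theorem le_dampFactor_mean (hp0 : 0 ≤ p) (hp1 : p ≤ 1) (hM : ∀ A ⊆ E, IsEdgeMatching (M A))
    (hC : C ⊆ E) {e : Sym2 V} (he : ¬ e.IsDiag) :
    67 / 100 ≤ 𝔼[p,E] (fun A => dampFactor (M A ∩ C) (coverProb M p E (E \ C)) e) := by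
  have hP := isFinLaw_realizationProb hp0 hp1 E
  refine le_trans ?_ (hP.mono fun A _ => le_max_right _ _)
  rw [finMean_sub, hP.const, finMean_sum]
  have h := Finset.sum_le_sum fun v (_ : v ∈ Finset.univ.filter fun v => v ∈ e) =>
    damp_mean_le hp0 hp1 hM hC v
  rw [Finset.sum_const, card_filter_mem_eq_two he fun v _ => Finset.mem_univ v] at h
  norm_num at h
  linarith

/-- Heavy edges are almost certainly queried. -/
theorem le_queried_mean (hp0 : 0 ≤ p) (hp1 : p ≤ 1) {e : Sym2 V}
    (hq : 100 ≤ R * matchProb M p E e) :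
    99 / 100 ≤ 𝔼^[R,p,E] (fun ω => if e ∈ queriedEdges M ω then 1 else 0) := by
  have hP := isFinLaw_realizationProb hp0 hp1 E
  set q := matchProb M p E e with hqdef
  have hq0 : 0 ≤ q := matchProb_nonneg hp0 hp1 e
  have hq1 : q ≤ 1 := (hP.mono fun A _ => by split_ifs <;> norm_num).trans (hP.const 1).le
  have h1 : ∀ ω : Fin R → Finset (Sym2 V), (if e ∈ queriedEdges M ω then (1 : ℝ) else 0) =
      1 - ∏ r, (1 - if e ∈ M (ω r) then 1 else 0) := by
    intro ω
    split_ifs with h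
    · obtain ⟨r, _, hr⟩ := Finset.mem_biUnion.1 h
      rw [Finset.prod_eq_zero (Finset.mem_univ r) (by rw [if_pos hr, sub_self]), sub_zero]
    · rw [Finset.prod_eq_one fun r _ => ?_, sub_self]
      rw [if_neg fun hr => h (Finset.mem_biUnion.2 ⟨r, Finset.mem_univ r, hr⟩), sub_zero]
  simp only [h1]
  rw [finMean_sub, hP.pi.const,
    IsFinLaw.finMean_pi_prod fun _ A => 1 - if e ∈ M A then 1 else 0]
  rw [finMean_sub, hP.const, Finset.prod_const, Finset.card_univ, Fintype.card_fin]
  change 99 / 100 ≤ 1 - (1 - q) ^ R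
  -- The inequality of Bernoulli bounds `(1 + q) ^ R` from below.
  have h2 : 1 + R * q ≤ (1 + q) ^ R := one_add_mul_le_pow (by linarith) R
  have h3 : (1 - q) ^ R * (1 + q) ^ R ≤ 1 := by
    rw [← mul_pow]
    exact pow_le_one₀ (by nlinarith) (by nlinarith)
  have h4 : 0 ≤ (1 - q) ^ R := pow_nonneg (by linarith) R
  nlinarith [mul_le_mul_of_nonneg_left (by linarith : 101 ≤ (1 + q) ^ R) h4]

/-- For a fixed realization `A`, a vertex is rarely overloaded unless its expected load given `A` is
too large already. -/
theorem overload_mean_le_of_realization (hp0 : 0 < p) (hp1 : p ≤ 1)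
    (hM : ∀ A ⊆ E, IsEdgeMatching (M A)) (hC : C ⊆ E) (hR : 10 ^ 10 ≤ R * p) (r : Fin R)
    (e : Sym2 V) (v : V) (A : Finset (Sym2 V)) :
    𝔼^[R,p,E] (fun ω => (if e ∈ M (ω r) then 1 else 0) *
      if coverProb M p E (E \ C) v + 1 / 100 <
        ∑ i ∈ E \ C with v ∈ i, lightValue M p ω A i then 1 else 0) ≤
    matchProb M p E e * ((if 1 / 200 < ∑ i ∈ E \ C with v ∈ i,
      matchProb M p E i / p * ((if i ∈ A then 1 else 0) - p) then 1 else 0) + 1 / 1000) := by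
  have hP := isFinLaw_realizationProb hp0.le hp1 E
  have hq0 : 0 ≤ matchProb M p E e := matchProb_nonneg hp0.le hp1 e
  have hn1 : coverProb M p E (E \ C) v ≤ 1 := by
    have := coverProb_add_coverProb_le_one hp0.le hp1 hM C hC v
    linarith [coverProb_nonneg (M := M) (E := E) hp0.le hp1 C v]
  have hdev : ∑ i ∈ E \ C with v ∈ i, matchProb M p E i / p * ((if i ∈ A then 1 else 0) - p) =
      (∑ i ∈ ((E \ C).filter fun i => v ∈ i).filter (fun i => i ∈ A), matchProb M p E i) / p -
        coverProb M p E (E \ C) v := by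
    rw [coverProb, Finset.sum_filter (fun i => i ∈ A), Finset.sum_div, ← Finset.sum_sub_distrib]
    refine Finset.sum_congr rfl fun i _ => ?_
    split_ifs
    · field_simp
    · field_simp
      ring
  have hload : ∀ ω : Fin R → Finset (Sym2 V),
      ∑ i ∈ E \ C with v ∈ i, lightValue M p ω A i =
        (∑ r', ∑ i ∈ ((E \ C).filter fun i => v ∈ i).filter (fun i => i ∈ A),
          if i ∈ M (ω r') then 1 else 0) / (R * p) := by
    intro ω
    rw [Finset.sum_comm, Finset.sum_filter (fun i => i ∈ A), Finset.sum_div]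
    refine Finset.sum_congr rfl fun i _ => ?_
    unfold lightValue
    split_ifs
    exacts [rfl, (zero_div _).symm]
  rw [hdev]
  simp only [hload]
  set T := ((E \ C).filter fun i => v ∈ i).filter (fun i => i ∈ A) with hT
  have hTv : ∀ i ∈ T, v ∈ i := fun i hi =>
    (Finset.mem_filter.1 (Finset.mem_filter.1 hi).1).2
  set n := coverProb M p E (E \ C) v
  set π := ∑ i ∈ T, matchProb M p E i with hπ
  have hRp : (0 : ℝ) < R * p := by linarith [show (0 : ℝ) < 10 ^ 10 by norm_num]
  split_ifs with hbad
  · have h1 : 𝔼^[R,p,E] (fun ω => (if e ∈ M (ω r) then 1 else 0) * if n + 1 / 100 <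
        (∑ r', ∑ i ∈ T, if i ∈ M (ω r') then 1 else 0) / (R * p) then 1 else 0) ≤
        𝔼^[R,p,E] (fun ω => if e ∈ M (ω r) then 1 else 0) :=
      hP.pi.mono fun ω _ => by split_ifs <;> norm_num
    rw [hP.finMean_pi_eval r fun B => if e ∈ M B then 1 else 0] at h1
    change _ ≤ matchProb M p E e at h1
    linarith
  · have hπ2 : π ≤ p * (n + 1 / 200) := by
      rw [not_lt, sub_le_iff_le_add, div_le_iff₀ hp0] at hbad
      linarith
    have hmean : 𝔼[p,E] (fun B => ∑ i ∈ T, if i ∈ M B then (1 : ℝ) else 0) = π :=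
      finMean_sum_ite_mem_eq_sum_matchProb T
    have h1 := hP.finMean_pi_exceed_le r (φ := fun B => if e ∈ M B then 1 else 0)
      (g := fun B => ∑ i ∈ T, if i ∈ M B then (1 : ℝ) else 0)
      (fun B _ => by split_ifs <;> norm_num)
      (fun B hB => ⟨Finset.sum_nonneg fun i _ => by split_ifs <;> norm_num,
        sum_ite_mem_le_one (hM B (Finset.mem_powerset.1 hB)) hTv⟩)
      (t := R * p / 200) (by linarith)
    rw [hmean, Fintype.card_fin] at h1
    change _ ≤ matchProb M p E e * _ / _ at h1
    refine le_trans (hP.pi.mono fun ω _ => ?_) (h1.trans ?_)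
    · refine mul_le_mul_of_nonneg_left ?_ (by split_ifs <;> norm_num)
      simp only [lt_div_iff₀ hRp]
      split_ifs with ha hb
      · exact le_refl _
      · exfalso
        refine hb (lt_of_le_of_lt ?_ ha)
        have : (R : ℝ) * π ≤ R * (p * (n + 1 / 200)) :=
          mul_le_mul_of_nonneg_left hπ2 (Nat.cast_nonneg R)
        linarith
      · exact zero_le_one
      · exact le_refl _
    · rw [mul_div_assoc, zero_add]
      refine mul_le_mul_of_nonneg_left ?_ hq0
      rw [div_le_iff₀ (by positivity)]
      have h2 : (R : ℝ) * π ≤ R * (p * 2) :=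
        mul_le_mul_of_nonneg_left (hπ2.trans (mul_le_mul_of_nonneg_left (by linarith) hp0.le))
          (Nat.cast_nonneg R)
      nlinarith

/-- A vertex is rarely overloaded, even on the event that a given light edge is used in a given round
and realized. -/
theorem overload_mean_le (hp0 : 0 < p) (hp1 : p ≤ 1) (hM : ∀ A ⊆ E, IsEdgeMatching (M A))
    (hC : C ⊆ E) (hlight : ∀ i ∈ E \ C, matchProb M p E i ≤ p / 10 ^ 8) (hR : 10 ^ 10 ≤ R * p)
    (r : Fin R) {e : Sym2 V} (he : e ∈ E \ C) {v : V} (hv : v ∈ e) :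
    𝔼[p,E] (fun A => 𝔼^[R,p,E] fun ω => (if e ∈ A then 1 else 0) *
      ((if e ∈ M (ω r) then 1 else 0) * if coverProb M p E (E \ C) v + 1 / 100 <
        ∑ i ∈ E \ C with v ∈ i, lightValue M p ω A i then 1 else 0)) ≤
    p * matchProb M p E e / 400 := by
  have hP := isFinLaw_realizationProb hp0.le hp1 E
  have hq0 : ∀ i, 0 ≤ matchProb M p E i := fun i => matchProb_nonneg hp0.le hp1 i
  set T := (E \ C).filter fun i => v ∈ i with hT
  have hTE : T ⊆ E := (Finset.filter_subset _ _).trans Finset.sdiff_subset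
  have heT : e ∈ T := Finset.mem_filter.2 ⟨he, hv⟩
  have hn1 : ∑ i ∈ T, matchProb M p E i ≤ 1 := by
    have := coverProb_add_coverProb_le_one hp0.le hp1 hM C hC v
    have h2 := coverProb_nonneg (M := M) (E := E) hp0.le hp1 C v
    change coverProb M p E (E \ C) v ≤ 1
    linarith
  have hb : ∀ i ∈ T, 0 ≤ matchProb M p E i / p ∧ matchProb M p E i / p ≤ 1 / 10 ^ 8 := by
    intro i hi
    refine ⟨div_nonneg (hq0 i) hp0.le, ?_⟩
    rw [div_le_iff₀ hp0]
    linarith [hlight i (Finset.mem_filter.1 hi).1]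
  have hsq : p * ∑ i ∈ T, (matchProb M p E i / p) ^ 2 ≤ 1 / 10 ^ 8 := by
    rw [Finset.mul_sum]
    have : ∀ i ∈ T, p * (matchProb M p E i / p) ^ 2 ≤ 1 / 10 ^ 8 * matchProb M p E i := by
      intro i hi
      have h1 : p * (matchProb M p E i / p) ^ 2 =
          matchProb M p E i / p * matchProb M p E i := by field_simp
      rw [h1]
      exact mul_le_mul_of_nonneg_right (hb i hi).2 (hq0 i)
    refine (Finset.sum_le_sum this).trans ?_
    rw [← Finset.mul_sum]
    linarith
  have hcheb : 𝔼[p,E] (fun A => (if e ∈ A then 1 else 0) * if 1 / 200 < ∑ i ∈ T,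
      matchProb M p E i / p * ((if i ∈ A then 1 else 0) - p) then 1 else 0) ≤ p / 1000 := by
    refine (hP.chebyshev (fun A _ => by split_ifs <;> norm_num) (by norm_num)).trans ?_
    have h1 := finMean_realization_deviation_le hp0.le hp1 hTE heT fun i => matchProb M p E i / p
    rw [div_le_iff₀ (by norm_num)]
    refine h1.trans ?_
    have h2 := (hb e heT).2
    have h3 : (matchProb M p E e / p) ^ 2 ≤ 1 / 10 ^ 8 := by nlinarith [(hb e heT).1]
    have h4 := mul_le_mul_of_nonneg_left (add_le_add hsq h3) hp0.le
    nlinarith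
  have hstep : 𝔼[p,E] (fun A => 𝔼^[R,p,E] fun ω => (if e ∈ A then 1 else 0) *
      ((if e ∈ M (ω r) then 1 else 0) * if coverProb M p E (E \ C) v + 1 / 100 <
        ∑ i ∈ T, lightValue M p ω A i then 1 else 0)) ≤
      𝔼[p,E] (fun A => matchProb M p E e * ((if e ∈ A then 1 else 0) * (if 1 / 200 < ∑ i ∈ T,
        matchProb M p E i / p * ((if i ∈ A then 1 else 0) - p) then 1 else 0) +
          (if e ∈ A then 1 else 0) * (1 / 1000))) := by
    refine hP.mono fun A _ => ?_
    rw [finMean_const_mul, ← mul_add, mul_left_comm]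
    exact mul_le_mul_of_nonneg_left (overload_mean_le_of_realization hp0 hp1 hM hC hR r e v A)
      (by split_ifs <;> norm_num)
  refine hstep.trans ?_
  rw [finMean_const_mul, finMean_add, finMean_mul_const,
    finMean_realization_mem hp0.le hp1 (hTE heT)]
  have := mul_le_mul_of_nonneg_left hcheb (hq0 e)
  have h2 : 0 ≤ matchProb M p E e * p := mul_nonneg (hq0 e) hp0.le
  linarith

variable [Fintype V] in
/-- On average, the kept part of a light edge is almost as large as the probability that the rule
uses the edge. -/
theorem le_tamePart_mean (hp0 : 0 < p) (hp1 : p ≤ 1) (hM : ∀ A ⊆ E, IsEdgeMatching (M A))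
    (hC : C ⊆ E) (hlight : ∀ i ∈ E \ C, matchProb M p E i ≤ p / 10 ^ 8) (hR : 10 ^ 10 ≤ R * p)
    {e : Sym2 V} (he : e ∈ E \ C) (hd : ¬ e.IsDiag) :
    99 / 100 * matchProb M p E e ≤ 𝔼[p,E] (fun A => 𝔼^[R,p,E] fun ω =>
      tamePart (E \ C) (lightValue M p ω A) (coverProb M p E (E \ C)) e) := by
  have hP := isFinLaw_realizationProb hp0.le hp1 E
  have hq0 : 0 ≤ matchProb M p E e := matchProb_nonneg hp0.le hp1 e
  have hRp : (0 : ℝ) < R * p := by linarith [show (0 : ℝ) < 10 ^ 10 by norm_num]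
  have hRq : R * matchProb M p E e ≤ R * p / 10 ^ 8 := by
    rw [mul_div_assoc]
    exact mul_le_mul_of_nonneg_left (hlight e he) (Nat.cast_nonneg R)
  -- The use of `e` in round `r` when `e` is realized, and its parts on the two kinds of bad events.
  let f : Fin R → Finset (Sym2 V) → (Fin R → Finset (Sym2 V)) → ℝ := fun r A ω =>
    (if e ∈ A then 1 else 0) * if e ∈ M (ω r) then 1 else 0
  let g : Fin R → Finset (Sym2 V) → (Fin R → Finset (Sym2 V)) → ℝ := fun r A ω =>
    (if e ∈ A then 1 else 0) * ((if e ∈ M (ω r) then 1 else 0) *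
      if R * matchProb M p E e + R * p / 5 < ∑ i, (if e ∈ M (ω i) then 1 else 0) then 1 else 0)
  let h : Fin R → V → Finset (Sym2 V) → (Fin R → Finset (Sym2 V)) → ℝ := fun r v A ω =>
    (if e ∈ A then 1 else 0) * ((if e ∈ M (ω r) then 1 else 0) *
      if coverProb M p E (E \ C) v + 1 / 100 <
        ∑ i ∈ E \ C with v ∈ i, lightValue M p ω A i then 1 else 0)
  have hf0 : ∀ r A ω, 0 ≤ f r A ω := fun r A ω => by
    simp only [f]
    split_ifs <;> norm_num
  have hg0 : ∀ r A ω, 0 ≤ g r A ω := fun r A ω => by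
    simp only [g]
    split_ifs <;> norm_num
  have hh0 : ∀ r v A ω, 0 ≤ h r v A ω := fun r v A ω => by
    simp only [h]
    split_ifs <;> norm_num
  have hpoint : ∀ A ω, 1 / (R * p) * ∑ r, (f r A ω - g r A ω - ∑ v with v ∈ e, h r v A ω) ≤
      tamePart (E \ C) (lightValue M p ω A) (coverProb M p E (E \ C)) e := by
    intro A ω
    have hhs : ∀ r, 0 ≤ ∑ v with v ∈ e, h r v A ω := fun r =>
      Finset.sum_nonneg fun v _ => hh0 r v A ω
    have hlv : lightValue M p ω A e = 1 / (R * p) * ∑ r, f r A ω := by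
      simp only [lightValue, f]
      split_ifs
      · rw [div_eq_inv_mul, one_div]
        simp only [one_mul]
      · simp
    unfold tamePart
    split_ifs with ht
    · rw [hlv]
      refine mul_le_mul_of_nonneg_left (Finset.sum_le_sum fun r _ => ?_) (by positivity)
      linarith [hg0 r A ω, hhs r]
    · refine mul_nonpos_of_nonneg_of_nonpos (by positivity) (Finset.sum_nonpos fun r _ => ?_)
      by_cases hv : ∃ v ∈ e, coverProb M p E (E \ C) v + 1 / 100 <
          ∑ i ∈ E \ C with v ∈ i, lightValue M p ω A i
      · obtain ⟨v, hve, hv⟩ := hv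
        have h1 : h r v A ω = f r A ω := by
          simp only [h, f, if_pos hv, mul_one]
        have h2 := Finset.single_le_sum (f := fun v => h r v A ω) (fun v _ => hh0 r v A ω)
          (Finset.mem_filter.2 ⟨Finset.mem_univ v, hve⟩ : v ∈ Finset.univ.filter fun v => v ∈ e)
        simp only [h1] at h2
        linarith [hg0 r A ω]
      · push Not at hv
        have hbig : 3 / 10 < lightValue M p ω A e := by
          by_contra hle
          exact ht ⟨not_lt.1 hle, hv⟩
        have hA : e ∈ A := by
          by_contra hA
          rw [lightValue, if_neg hA] at hbig
          norm_num at hbig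
        rw [lightValue, if_pos hA, lt_div_iff₀ hRp] at hbig
        have h1 : g r A ω = f r A ω := by
          simp only [g, f]
          rw [if_pos (lt_of_le_of_lt (by linarith) hbig : R * matchProb M p E e + R * p / 5 <
            ∑ i, if e ∈ M (ω i) then (1 : ℝ) else 0), mul_one]
        linarith [hhs r]
  have hmean : 𝔼[p,E] (fun A => 𝔼^[R,p,E] fun ω =>
      1 / (R * p) * ∑ r, (f r A ω - g r A ω - ∑ v with v ∈ e, h r v A ω)) =
      1 / (R * p) * ∑ r, (𝔼[p,E] (fun A => 𝔼^[R,p,E] (f r A)) -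
        𝔼[p,E] (fun A => 𝔼^[R,p,E] (g r A)) -
        ∑ v with v ∈ e, 𝔼[p,E] (fun A => 𝔼^[R,p,E] (h r v A))) := by
    simp only [finMean_const_mul, finMean_sum, finMean_sub]
  have hf : ∀ r, 𝔼[p,E] (fun A => 𝔼^[R,p,E] (f r A)) = p * matchProb M p E e := by
    intro r
    simp only [f, finMean_const_mul]
    rw [finMean_mul_const, finMean_realization_mem hp0.le hp1 (Finset.mem_sdiff.1 he).1,
      hP.finMean_pi_eval r fun B => if e ∈ M B then 1 else 0]
    rfl
  have hg : ∀ r, 𝔼[p,E] (fun A => 𝔼^[R,p,E] (g r A)) ≤ p * matchProb M p E e / 400 := by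
    intro r
    have h1 := hP.finMean_pi_exceed_le r (φ := fun B => if e ∈ M B then 1 else 0)
      (g := fun B => if e ∈ M B then (1 : ℝ) else 0)
      (fun B _ => by split_ifs <;> norm_num) (fun B _ => by split_ifs <;> norm_num)
      (t := R * p / 5) (by linarith)
    rw [Fintype.card_fin] at h1
    change _ ≤ matchProb M p E e * (R * matchProb M p E e + 1) / _ at h1
    simp only [g, finMean_const_mul]
    rw [finMean_mul_const, finMean_realization_mem hp0.le hp1 (Finset.mem_sdiff.1 he).1,
      mul_div_assoc p]
    refine mul_le_mul_of_nonneg_left (h1.trans ?_) hp0.le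
    rw [mul_div_assoc, div_eq_mul_one_div (matchProb M p E e) 400]
    refine mul_le_mul_of_nonneg_left ?_ hq0
    rw [div_le_iff₀ (by positivity)]
    nlinarith
  have hh : ∀ r, ∑ v with v ∈ e, 𝔼[p,E] (fun A => 𝔼^[R,p,E] (h r v A)) ≤
      2 * (p * matchProb M p E e / 400) := by
    intro r
    have h1 := Finset.sum_le_sum fun v (hv : v ∈ Finset.univ.filter fun v => v ∈ e) =>
      overload_mean_le hp0 hp1 hM hC hlight hR r he (Finset.mem_filter.1 hv).2
    rw [Finset.sum_const, card_filter_mem_eq_two hd fun v _ => Finset.mem_univ v,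
      nsmul_eq_mul, Nat.cast_ofNat] at h1
    exact h1
  refine le_trans ?_ ((hP.mono fun A _ => hP.pi.mono fun ω _ => hpoint A ω))
  rw [hmean]
  have hsum := Finset.sum_le_sum fun r (_ : r ∈ (Finset.univ : Finset (Fin R))) =>
    (by rw [hf]; linarith [hg r, hh r, mul_nonneg hp0.le hq0] : 99 / 100 * (p * matchProb M p E e) ≤
      𝔼[p,E] (fun A => 𝔼^[R,p,E] (f r A)) - 𝔼[p,E] (fun A => 𝔼^[R,p,E] (g r A)) -
        ∑ v with v ∈ e, 𝔼[p,E] (fun A => 𝔼^[R,p,E] (h r v A)))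
  rw [Finset.sum_const, Finset.card_univ, Fintype.card_fin, nsmul_eq_mul] at hsum
  rw [one_div_mul_eq_div, le_div_iff₀ hRp]
  linarith

theorem tamePart_congr {N : Finset (Sym2 V)} {X X' : Sym2 V → ℝ} {n : V → ℝ}
    (h : ∀ i ∈ N, X i = X' i) {e : Sym2 V} (he : e ∈ N) :
    tamePart N X n e = tamePart N X' n e := by
  have h1 : ∀ v, ∑ i ∈ N with v ∈ i, X i = ∑ i ∈ N with v ∈ i, X' i := fun v =>
    Finset.sum_congr rfl fun i hi => h i (Finset.mem_filter.1 hi).1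
  have h2 : IsTame N X n e ↔ IsTame N X' n e := by simp only [IsTame, h1, h e he]
  by_cases ht : IsTame N X n e
  · rw [tamePart, tamePart, if_pos ht, if_pos (h2.1 ht), h e he]
  · rw [tamePart, tamePart, if_neg ht, if_neg fun h => ht (h2.2 h)]

end Expectation

/-! ### The algorithm -/

section Algorithm

variable {V : Type*} [Fintype V] [DecidableEq V] {M : Finset (Sym2 V) → Finset (Sym2 V)} {p : ℝ}
  {E : Finset (Sym2 V)} {R : ℕ}

/-- Compared with the matching of a realization, the combined fractional matching keeps a share of
at least `0.6263` of every edge on average. Its heavy part is drawn from the realization that agrees with the true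
one on the heavy edges and with an independent one elsewhere, so that it is independent of the
values of the light edges. -/
theorem le_combined_mean {C : Finset (Sym2 V)} (hp0 : 0 < p) (hp1 : p ≤ 1)
    (hloop : ∀ e ∈ E, ¬ e.IsDiag) (hM : ∀ A ⊆ E, IsEdgeMatching (M A)) (hC : C ⊆ E)
    (hlight : ∀ i ∈ E \ C, matchProb M p E i ≤ p / 10 ^ 8)
    (hheavy : ∀ i ∈ C, p / 10 ^ 8 ≤ matchProb M p E i) (hR : 10 ^ 10 ≤ R * p)
    {e : Sym2 V} (he : e ∈ E) :
    6263 / 10000 * matchProb M p E e ≤ 𝔼^[R,p,E] (fun ω => 𝔼[p,E] fun A => 𝔼[p,E] fun B =>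
      combined (queriedEdges M ω) (M (mixRealization C A B) ∩ C) (E \ C) (lightValue M p ω A)
        (coverProb M p E (E \ C)) e) := by
  have hP := isFinLaw_realizationProb hp0.le hp1 E
  have hq0 : 0 ≤ matchProb M p E e := matchProb_nonneg hp0.le hp1 e
  by_cases heC : e ∈ C
  · have hin : ∀ ω : Fin R → Finset (Sym2 V), 𝔼[p,E] (fun A => 𝔼[p,E] fun B =>
        combined (queriedEdges M ω) (M (mixRealization C A B) ∩ C) (E \ C) (lightValue M p ω A)
          (coverProb M p E (E \ C)) e) =
        16 / 25 * matchProb M p E e * if e ∈ queriedEdges M ω then 1 else 0 := by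
      intro ω
      have h1 := finMean_mixRealization (p := p) (E := E) C
        (fun B => 16 / 25 * if e ∈ M B then 1 else 0)
        (fun _ => if e ∈ queriedEdges M ω then 1 else 0) fun _ => rfl
      rw [hP.const, finMean_const_mul] at h1
      refine Eq.trans ?_ h1
      refine finMean_congr fun A _ => finMean_congr fun B _ => ?_
      rw [combined, if_neg fun h => (Finset.mem_sdiff.1 h).2 heC, mul_assoc]
      congr 1
      simp only [Finset.mem_inter, heC, and_true]
      split_ifs <;> first | tauto | norm_num
    simp only [hin]
    rw [finMean_const_mul]
    have hq : 100 ≤ R * matchProb M p E e := by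
      have := mul_le_mul_of_nonneg_left (hheavy e heC) (Nat.cast_nonneg (α := ℝ) R)
      linarith
    have := mul_le_mul_of_nonneg_left (le_queried_mean hp0.le hp1 hq)
      (by positivity : 0 ≤ 16 / 25 * matchProb M p E e)
    linarith
  · have heN : e ∈ E \ C := Finset.mem_sdiff.2 ⟨he, heC⟩
    have hin : ∀ ω : Fin R → Finset (Sym2 V), 𝔼[p,E] (fun A => 𝔼[p,E] fun B =>
        combined (queriedEdges M ω) (M (mixRealization C A B) ∩ C) (E \ C) (lightValue M p ω A)
          (coverProb M p E (E \ C)) e) =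
        𝔼[p,E] (fun A => dampFactor (M A ∩ C) (coverProb M p E (E \ C)) e) *
          𝔼[p,E] fun A =>
            tamePart (E \ C) (lightValue M p ω A) (coverProb M p E (E \ C)) e := by
      intro ω
      refine Eq.trans ?_ (finMean_mixRealization (p := p) (E := E) C
        (fun B => dampFactor (M B ∩ C) (coverProb M p E (E \ C)) e)
        (fun A => tamePart (E \ C) (lightValue M p ω A) (coverProb M p E (E \ C)) e)
        fun A => tamePart_congr (fun i hi => ?_) heN)
      · refine finMean_congr fun A _ => finMean_congr fun B _ => ?_
        rw [combined, if_pos heN]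
      · simp only [lightValue, Finset.mem_sdiff, (Finset.mem_sdiff.1 hi).2, not_false_eq_true,
          and_true]
    simp only [hin]
    rw [finMean_const_mul, finMean_comm]
    have h1 := le_dampFactor_mean hp0.le hp1 hM hC (hloop e he)
    have h2 := le_tamePart_mean hp0 hp1 hM hC hlight hR heN (hloop e he)
    nlinarith [mul_le_mul h1 h2 (by positivity) (by linarith)]

theorem le_algExpWeight {w : Sym2 V → ℝ} (hp0 : 0 < p) (hp1 : p ≤ 1)
    (hloop : ∀ e ∈ E, ¬ e.IsDiag) (hw : ∀ e ∈ E, 0 ≤ w e)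
    (hM : ∀ A ⊆ E, IsMaxWeightMatching w A (M A)) (hR : 10 ^ 10 ≤ R * p) :
    0.501 * expMatching w M p E E ≤ algExpWeight w M p E R := by
  have hP := isFinLaw_realizationProb hp0.le hp1 E
  have hMm : ∀ A ⊆ E, IsEdgeMatching (M A) := fun A hA => (hM A hA).1.2
  -- An edge is heavy if the rule uses it with probability at least `p / 10 ^ 8`.
  let C := E.filter fun e => p / 10 ^ 8 ≤ matchProb M p E e
  have hC : C ⊆ E := Finset.filter_subset _ _
  have hheavy : ∀ i ∈ C, p / 10 ^ 8 ≤ matchProb M p E i := fun i hi => (Finset.mem_filter.1 hi).2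
  have hlight : ∀ i ∈ E \ C, matchProb M p E i ≤ p / 10 ^ 8 := by
    intro i hi
    rw [Finset.mem_sdiff] at hi
    exact (not_le.1 fun h => hi.2 (Finset.mem_filter.2 ⟨hi.1, h⟩)).le
  have hn0 := coverProb_nonneg (M := M) (E := E) hp0.le hp1 (E \ C)
  have hn1 : ∀ v, coverProb M p E (E \ C) v ≤ 1 := fun v => by
    have := coverProb_add_coverProb_le_one hp0.le hp1 hMm C hC v
    linarith [coverProb_nonneg (M := M) (E := E) hp0.le hp1 C v]
  let y : (Fin R → Finset (Sym2 V)) → Finset (Sym2 V) → Finset (Sym2 V) → Sym2 V → ℝ :=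
    fun ω A B => combined (queriedEdges M ω) (M (mixRealization C A B) ∩ C) (E \ C)
      (lightValue M p ω A) (coverProb M p E (E \ C))
  have hround : ∀ (ω : Fin R → Finset (Sym2 V)), ∀ A ⊆ E, ∀ B ⊆ E,
      4 / 5 * ∑ e ∈ E, y ω A B e * w e ≤ ∑ e ∈ M (queriedEdges M ω ∩ A), w e := by
    intro ω A hA B hB
    have hmix : mixRealization C A B ⊆ E := fun e he => by
      rw [mem_mixRealization] at he
      rcases he with he | he
      exacts [hA he.1, hB he.1]
    have hSA : queriedEdges M ω ∩ A ⊆ E := Finset.inter_subset_right.trans hA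
    refine four_fifths_sum_combined_le hloop hw ((hMm _ hmix).subset Finset.inter_subset_left)
      Finset.sdiff_subset (lightValue_nonneg hp0.le ω A) hn0 hn1 hSA (fun e _ heB => ?_) (hM _ hSA)
    unfold combined
    split_ifs with heN hF
    · have hX : lightValue M p ω A e = 0 := by
        unfold lightValue
        split_ifs with heA
        · rw [Finset.sum_eq_zero fun r _ => if_neg fun hr => heB (Finset.mem_inter.2
            ⟨Finset.mem_biUnion.2 ⟨r, Finset.mem_univ r, hr⟩, heA⟩), zero_div]
        · rfl
      rw [tamePart, hX, ite_self, mul_zero]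
    · have h1 := Finset.mem_inter.1 hF.1
      rcases mem_mixRealization.1 ((hM _ hmix).1.1 h1.1) with h2 | h2
      · exact absurd (Finset.mem_inter.2 ⟨hF.2, h2.1⟩) heB
      · exact absurd h1.2 h2.2
    · exact mul_zero _
  have hlow : 𝔼^[R,p,E] (fun ω => 𝔼[p,E] fun A => 𝔼[p,E] fun B =>
      4 / 5 * ∑ e ∈ E, y ω A B e * w e) ≤ algExpWeight w M p E R := by
    refine hP.pi.mono fun ω _ => hP.mono fun A hA => ?_
    refine (hP.mono fun B hB => hround ω A (Finset.mem_powerset.1 hA) B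
      (Finset.mem_powerset.1 hB)).trans (hP.const _).le
  have hmean : 𝔼^[R,p,E] (fun ω => 𝔼[p,E] fun A => 𝔼[p,E] fun B =>
      4 / 5 * ∑ e ∈ E, y ω A B e * w e) =
      4 / 5 * ∑ e ∈ E, 𝔼^[R,p,E] (fun ω => 𝔼[p,E] fun A => 𝔼[p,E] fun B => y ω A B e) * w e := by
    simp only [finMean_const_mul, finMean_sum, finMean_mul_const]
  refine le_trans ?_ hlow
  rw [hmean, expMatching_eq_sum fun A hA => (hM A hA).1.1, Finset.mul_sum, Finset.mul_sum]
  refine Finset.sum_le_sum fun e he => ?_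
  have h1 := mul_le_mul_of_nonneg_right
    (le_combined_mean hp0 hp1 hloop hMm hC hlight hheavy hR he) (hw e he)
  have h2 := mul_nonneg (matchProb_nonneg (M := M) (E := E) hp0.le hp1 e) (hw e he)
  norm_num at h1 ⊢
  linarith

end Algorithm

/-! ### The number of rounds -/

theorem le_numRounds_mul {ε p : ℝ} (hε0 : 0 < ε) (hε1 : ε ≤ 1 / 1000) (hp0 : 0 < p)
    (hp1 : p ≤ 1) : 10 ^ 10 ≤ (numRounds ε p : ℝ) * p := by
  have hlog : ∀ x : ℝ, 0 < x → x ≤ 1 / 1000 → 1 ≤ Real.log (1 / x) := by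
    intro x hx0 hx1
    rw [Real.le_log_iff_exp_le (by positivity), le_div_iff₀ hx0]
    nlinarith [Real.exp_one_lt_d9]
  have h1 := hlog ε hε0 hε1
  have h2 := hlog (ε * p) (by positivity) (by nlinarith)
  have h3 : 2000 * Real.log (1 / ε) * Real.log (1 / (ε * p)) / (ε ^ 4 * p) ≤ numRounds ε p :=
    Nat.le_ceil _
  rw [div_le_iff₀ (by positivity)] at h3
  have h4 : ε ^ 4 ≤ (1 / 1000) ^ 4 := pow_le_pow_left₀ hε0.le hε1 4
  have h5 : 1 ≤ Real.log (1 / ε) * Real.log (1 / (ε * p)) := by nlinarith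
  have h6 : (numRounds ε p : ℝ) * p * ε ^ 4 ≤ (numRounds ε p : ℝ) * p * (1 / 1000) ^ 4 :=
    mul_le_mul_of_nonneg_left h4 (by positivity)
  nlinarith

theorem exists_numRounds_le {ε : ℝ} (hε0 : 0 < ε) (hε1 : ε ≤ 1 / 1000) (p₀ : ℝ) (hp₀ : p₀ < 1) :
    ∃ K : ℝ, ∀ p : ℝ, 0 < p → p ≤ p₀ →
      (numRounds ε p : ℝ) ≤ K * (Real.log (1 / p) / p) := by
  rcases le_or_gt p₀ 0 with hneg | hpos
  · exact ⟨0, fun p h1 h2 => absurd (h1.trans_le h2) (not_lt.2 hneg)⟩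
  have hl : 0 < Real.log (1 / p₀) := Real.log_pos (by rw [lt_div_iff₀ hpos]; linarith)
  have ha : 0 < Real.log (1 / ε) := Real.log_pos (by rw [lt_div_iff₀ hε0]; linarith)
  set l := Real.log (1 / p₀) with hl_def
  set a := Real.log (1 / ε) with ha_def
  refine ⟨2000 * a / ε ^ 4 * (a / l + 1) + 1 / l, fun p hp0 hpp => ?_⟩
  have hlp : l ≤ Real.log (1 / p) :=
    Real.log_le_log (by positivity) (one_div_le_one_div_of_le hp0 hpp)
  have hlog : Real.log (1 / (ε * p)) = a + Real.log (1 / p) := by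
    rw [ha_def, ← Real.log_mul (by positivity) (by positivity), one_div_mul_one_div]
  set b := Real.log (1 / p)
  have hceil : (numRounds ε p : ℝ) < 2000 * a * (a + b) / (ε ^ 4 * p) + 1 := by
    rw [← hlog]
    refine Nat.ceil_lt_add_one ?_
    rw [hlog]
    have : 0 ≤ a + b := by linarith
    positivity
  have hab : a ≤ a / l * b := by
    rw [div_mul_eq_mul_div, le_div_iff₀ hl]
    exact mul_le_mul_of_nonneg_left hlp ha.le
  have h1 : 2000 * a * (a + b) / (ε ^ 4 * p) ≤ 2000 * a / ε ^ 4 * (a / l + 1) * (b / p) := by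
    have : 2000 * a / ε ^ 4 * (a / l + 1) * (b / p) =
        2000 * a * (a / l * b + b) / (ε ^ 4 * p) := by field_simp
    rw [this]
    gcongr
  have h2 : 1 ≤ 1 / l * (b / p) := by
    rw [one_div_mul_eq_div, le_div_iff₀ hl, one_mul, le_div_iff₀ hp0]
    nlinarith
  rw [add_mul]
  linarith

theorem mainTheorem2 :
    ∃ ε₀ : ℝ, 0 < ε₀ ∧ ε₀ < 1 ∧ ∀ ε : ℝ, 0 < ε → ε ≤ ε₀ →
      (∀ p₀ : ℝ, p₀ < 1 → ∃ K : ℝ, ∀ p : ℝ, 0 < p → p ≤ p₀ →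
        (numRounds ε p : ℝ) ≤ K * (Real.log (1 / p) / p)) ∧
      ∀ p : ℝ, 0 < p → p ≤ 1 →
        ∀ (V : Type*) [Fintype V] [DecidableEq V] (G : SimpleGraph V) [DecidableRel G.Adj]
          (w : Sym2 V → ℝ) (M : Finset (Sym2 V) → Finset (Sym2 V)),
          (∀ e ∈ G.edgeFinset, 0 ≤ w e) →
          (∀ A : Finset (Sym2 V), A ⊆ G.edgeFinset → IsMaxWeightMatching w A (M A)) →
          (0.501 : ℝ) * expMatching w M p G.edgeFinset G.edgeFinset
              ≤ algExpWeight w M p G.edgeFinset (numRounds ε p) ∧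
            ∀ ω ∈ drawOutcomes (numRounds ε p) G.edgeFinset,
              queriedEdges M ω ⊆ G.edgeFinset ∧
              ∀ v : V, ((queriedEdges M ω).filter fun e => v ∈ e).card ≤ numRounds ε p := by
  refine ⟨1 / 1000, by norm_num, by norm_num, fun ε hε0 hε1 =>
    ⟨exists_numRounds_le hε0 hε1, fun p hp0 hp1 V _ _ G _ w M hw hM => ?_⟩⟩
  exact ⟨le_algExpWeight hp0 hp1 (fun e he => G.not_isDiag_of_mem_edgeFinset he) hw hM
      (le_numRounds_mul hε0 hε1 hp0 hp1),
    fun ω hω => ⟨queriedEdges_subset (fun A hA => (hM A hA).1.1) hω,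
      card_queriedEdges_filter_le (fun A hA => (hM A hA).1.2) hω⟩⟩
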